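/- Let $\widetilde A,\widetilde B$ be the transformations of the real line $\widetilde A(x)=x-1$ and $\widetilde B(x)=x$ for $x\le 0$, $\widetilde B(x)=x/2$ for $0\le x\le 2$, $\widetilde B(x)=x-1$ for $x\ge 2$, and let $\widetilde F$ (a copy of Thompson's group $F$) be the group generated by $\widetilde A,\widetilde B$, with the product $(g_1g_2)(x)=g_2(g_1(x))$, so that $\widetilde F$ acts on the right by $x.g=g(x)$. Let $\chi_a,\chi_b:\widetilde F\to\mathbb Z$ be the homomorphisms with $\chi_a(\widetilde A)=1$, $\chi_a(\widetilde B)=0$, $\chi_b(\widetilde A)=0$, $\chi_b(\widetilde B)=1$. Let $\Gamma$ be the Schreier graph of the action of $\widetilde F$ on the dyadic rationals $\mathbb Z[\frac12]$ with respect to the generating set $\{\widetilde A^{\pm1},\widetilde B^{\pm1}\}$, and $\partial\Gamma$ its space of ends. Let $\partial_-\Gamma$ be the set of ends determined by the rays $(x-n)_{n\ge1}$ with $x\in\mathbb Z[\frac12]\cap(0,1]$ (the rays of negative type, which fill $(-\infty,0]$), let $\partial_+\Gamma$ be the set of ends determined by the rays $(x+n)_{n\ge1}$ with $x\in\mathbb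 Z[\frac12]\cap[1,2)$ (the rays of positive type, which fill $[2,\infty)$), and let $\partial\overline\Gamma\subset\partial\Gamma$ be the set of ends of the skeleton $\overline\Gamma$, the subgraph of $\Gamma$ induced on the remaining vertices $\mathbb Z[\frac12]\cap(0,2)$. For $A\subset\partial\Gamma$ let $\operatorname{Fun}(\Gamma,A)$ be the set of all maps $\Gamma\to A$. Let $\mu$ be a finitely supported probability measure on $\widetilde F$ whose support generates $\widetilde F$ as a semigroup. Let $\mathbf P$ be the measure on the space of sample paths $(g_n)_{n\ge0}$ of the random walk $g_0=e$, $g_n=h_1h_2\cdots h_n$, where the $h_i$ are independent and $\mu$-distributed. Let $\alpha$ and $\beta$ be the barycentres (expectations) of the images $\chi_a(\mu)$ and $\chi_b(\mu)$ of $\mu$. Then for $\mathbf P$-almost every sample path $(g_n)$ and all $\gamma\in\Gamma$ the sequence $\gamma.g_n$ converges to an end $\omega_\gamma\in\partial\Gamma$. The image $\lambda$ of $\mathbf P$ under the almost everywhere defined map $(g_n)\mapsto(\omega_\gamma)_{\gamma\in\Gamma}$ is a Borel probability measure on $\operatorname{Fun}(\Gamma,\partial\Gamma)$, and it is concentrated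 on $$ \begin{cases} \operatorname{Fun}(\Gamma,\partial_-\Gamma\cup\partial_+\Gamma), & \text{if } \alpha>0 \text{ and } \alpha+\beta<0,\\ \operatorname{Fun}(\Gamma,\partial_-\Gamma), & \text{if } \alpha>0 \text{ and } \alpha+\beta\ge0,\\ \operatorname{Fun}(\Gamma,\partial_+\Gamma), & \text{if } \alpha\le0 \text{ and } \alpha+\beta<0,\\ \operatorname{Fun}(\Gamma,\partial\overline\Gamma), & \text{if } \alpha\le0 \text{ and } \alpha+\beta\ge0. \end{cases} $$ -/

import Mathlib

/-!
Thompson's group in its realization on the real line, its dyadic Schreier graph and the ends of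
that graph, random walks on the group, and the law of the limit end field.
-/

open MeasureTheory Filter

namespace ThompsonEnds

noncomputable section

/-! ## The group -/

/-- The generator `x ↦ x - 1`. -/
def genA : Equiv.Perm ℝ := Equiv.subRight 1

/-- The generator `x ↦ x` for `x ≤ 0`, `x / 2` for `0 ≤ x ≤ 2`, `x - 1` for `x ≥ 2`. -/
def genB : Equiv.Perm ℝ where
  toFun x := if x ≤ 0 then x else if x ≤ 2 then x / 2 else x - 1
  invFun x := if x ≤ 0 then x else if x ≤ 1 then 2 * x else x + 1
  left_inv x := by
    simp only
    split_ifs <;> linarith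
  right_inv x := by
    simp only
    split_ifs <;> linarith

/-- The group of transformations of the line generated by `genA` and `genB`, with the usual
composition of maps as its product. -/
def lineGroup : Subgroup (Equiv.Perm ℝ) := Subgroup.closure {genA, genB}

/-- Thompson's group acting on the line from the right: the opposite of `lineGroup`, so that the
product `g₁ * g₂` is the map `x ↦ g₂ (g₁ x)`. -/
abbrev FTilde : Type := (↥lineGroup)ᵐᵒᵖ

/-- The transformation of the line given by a group element. -/
def toFun (g : FTilde) (x : ℝ) : ℝ := g.unop.1 x

lemma toFun_mul (g₁ g₂ : FTilde) (x : ℝ) : toFun (g₁ * g₂) x = toFun g₂ (toFun g₁ x) := rfl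

lemma toFun_one (x : ℝ) : toFun 1 x = x := rfl

/-- `genA` as a group element. -/
def elA : FTilde := MulOpposite.op ⟨genA, Subgroup.subset_closure (by simp)⟩

/-- `genB` as a group element. -/
def elB : FTilde := MulOpposite.op ⟨genB, Subgroup.subset_closure (by simp)⟩

instance : Countable FTilde := by
  have h : Countable ↥lineGroup := by
    unfold lineGroup
    rw [FreeGroup.closure_eq_range]
    have h2 : Countable (FreeGroup ↥({genA, genB} : Set (Equiv.Perm ℝ))) :=
      Function.Surjective.countable (f := FreeGroup.mk) Quot.mk_surjective
    exact Set.countable_range _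
  exact MulOpposite.unop_injective.countable

instance : MeasurableSpace FTilde := ⊤

instance : DiscreteMeasurableSpace FTilde := ⟨fun _ => trivial⟩

/-! ## The two homomorphisms to the integers -/

lemma genA_apply (x : ℝ) : genA x = x - 1 := rfl

lemma genB_apply (x : ℝ) :
    genB x = if x ≤ 0 then x else if x ≤ 2 then x / 2 else x - 1 := rfl

lemma exists_shift (l : Filter ℝ) (hl : ∀ c : ℤ, Tendsto (fun x : ℝ => x + c) l l)
    (hB : ∃ c : ℤ, ∀ᶠ x in l, genB x = x + c) (g : FTilde) :
    ∃ c : ℤ, ∀ᶠ x in l, toFun g x = x + c := by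
  obtain ⟨g, hg⟩ := g
  change ∃ c : ℤ, ∀ᶠ x in l, g x = x + c
  induction hg using Subgroup.closure_induction with
  | mem x hx =>
    rcases hx with rfl | rfl
    · exact ⟨-1, Eventually.of_forall fun x => by rw [genA_apply]; push_cast; ring⟩
    · exact hB
  | one => exact ⟨0, Eventually.of_forall fun x => by simp⟩
  | mul f g _ _ hf hg =>
    obtain ⟨c, hc⟩ := hf
    obtain ⟨d, hd⟩ := hg
    refine ⟨d + c, ?_⟩
    filter_upwards [hd, (hl d).eventually hc] with x h1 h2
    rw [Equiv.Perm.mul_apply, h1, h2]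
    push_cast
    ring
  | inv f _ hf =>
    obtain ⟨c, hc⟩ := hf
    refine ⟨-c, ?_⟩
    filter_upwards [(hl (-c)).eventually hc] with x h
    rw [Equiv.Perm.inv_eq_iff_eq, h]
    push_cast
    ring

lemma exists_shift_atBot (g : FTilde) : ∃ c : ℤ, ∀ᶠ x in atBot, toFun g x = x + c := by
  refine exists_shift atBot (fun c => tendsto_atBot_add_const_right _ _ tendsto_id) ⟨0, ?_⟩ g
  filter_upwards [eventually_le_atBot (0 : ℝ)] with x hx
  simp [genB_apply, hx]

lemma exists_shift_atTop (g : FTilde) : ∃ c : ℤ, ∀ᶠ x in atTop, toFun g x = x + c := by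
  refine exists_shift atTop (fun c => tendsto_atTop_add_const_right _ _ tendsto_id) ⟨-1, ?_⟩ g
  filter_upwards [eventually_gt_atTop (2 : ℝ)] with x hx
  rw [genB_apply, if_neg (by linarith), if_neg (by linarith)]
  push_cast
  ring

/-- The integer `c` with `g x = x + c` for all `x` close to `-∞`. -/
def shiftBot (g : FTilde) : ℤ := (exists_shift_atBot g).choose

/-- The integer `c` with `g x = x + c` for all `x` close to `+∞`. -/
def shiftTop (g : FTilde) : ℤ := (exists_shift_atTop g).choose

lemma shiftBot_spec (g : FTilde) : ∀ᶠ x in atBot, toFun g x = x + shiftBot g :=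
  (exists_shift_atBot g).choose_spec

lemma shiftTop_spec (g : FTilde) : ∀ᶠ x in atTop, toFun g x = x + shiftTop g :=
  (exists_shift_atTop g).choose_spec

lemma shiftBot_eq {g : FTilde} {c : ℤ} (h : ∀ᶠ x in atBot, toFun g x = x + c) :
    shiftBot g = c := by
  obtain ⟨x, h1, h2⟩ := (h.and (shiftBot_spec g)).exists
  have h3 : (c : ℝ) = shiftBot g := by linarith
  exact_mod_cast h3.symm

lemma shiftTop_eq {g : FTilde} {c : ℤ} (h : ∀ᶠ x in atTop, toFun g x = x + c) :
    shiftTop g = c := by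
  obtain ⟨x, h1, h2⟩ := (h.and (shiftTop_spec g)).exists
  have h3 : (c : ℝ) = shiftTop g := by linarith
  exact_mod_cast h3.symm

lemma shiftBot_mul (f g : FTilde) : shiftBot (f * g) = shiftBot f + shiftBot g := by
  apply shiftBot_eq
  have ht : Tendsto (fun x : ℝ => x + shiftBot f) atBot atBot :=
    tendsto_atBot_add_const_right _ _ tendsto_id
  filter_upwards [shiftBot_spec f, ht.eventually (shiftBot_spec g)] with x h1 h2
  rw [toFun_mul, h1, h2]
  push_cast
  ring

lemma shiftTop_mul (f g : FTilde) : shiftTop (f * g) = shiftTop f + shiftTop g := by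
  apply shiftTop_eq
  have ht : Tendsto (fun x : ℝ => x + shiftTop f) atTop atTop :=
    tendsto_atTop_add_const_right _ _ tendsto_id
  filter_upwards [shiftTop_spec f, ht.eventually (shiftTop_spec g)] with x h1 h2
  rw [toFun_mul, h1, h2]
  push_cast
  ring

lemma shiftBot_one : shiftBot 1 = 0 :=
  shiftBot_eq (Eventually.of_forall fun x => by simp [toFun_one])

lemma shiftTop_one : shiftTop 1 = 0 :=
  shiftTop_eq (Eventually.of_forall fun x => by simp [toFun_one])

/-- The homomorphism to `ℤ` with `elA ↦ 1` and `elB ↦ 0` (see `chiA_elA`, `chiA_elB`). -/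
def chiA : FTilde →* Multiplicative ℤ where
  toFun g := Multiplicative.ofAdd (-shiftBot g)
  map_one' := by simp [shiftBot_one]
  map_mul' f g := by rw [shiftBot_mul, neg_add, ofAdd_add]

/-- The homomorphism to `ℤ` with `elA ↦ 0` and `elB ↦ 1` (see `chiB_elA`, `chiB_elB`). -/
def chiB : FTilde →* Multiplicative ℤ where
  toFun g := Multiplicative.ofAdd (shiftBot g - shiftTop g)
  map_one' := by simp [shiftBot_one, shiftTop_one]
  map_mul' f g := by
    rw [shiftBot_mul, shiftTop_mul, add_sub_add_comm, ofAdd_add]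

lemma shiftBot_elA : shiftBot elA = -1 := by
  refine shiftBot_eq (Eventually.of_forall fun x => ?_)
  change genA x = _
  rw [genA_apply]
  push_cast
  ring

lemma shiftTop_elA : shiftTop elA = -1 := by
  refine shiftTop_eq (Eventually.of_forall fun x => ?_)
  change genA x = _
  rw [genA_apply]
  push_cast
  ring

lemma shiftBot_elB : shiftBot elB = 0 := by
  apply shiftBot_eq
  filter_upwards [eventually_le_atBot (0 : ℝ)] with x hx
  change genB x = _
  simp [genB_apply, hx]

lemma shiftTop_elB : shiftTop elB = -1 := by
  apply shiftTop_eq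
  filter_upwards [eventually_gt_atTop (2 : ℝ)] with x hx
  change genB x = _
  rw [genB_apply, if_neg (by linarith), if_neg (by linarith)]
  push_cast
  ring

lemma chiA_elA : chiA elA = Multiplicative.ofAdd 1 := by
  change Multiplicative.ofAdd (-shiftBot elA) = _
  rw [shiftBot_elA, neg_neg]

lemma chiA_elB : chiA elB = Multiplicative.ofAdd 0 := by
  change Multiplicative.ofAdd (-shiftBot elB) = _
  rw [shiftBot_elB, neg_zero]

lemma chiB_elA : chiB elA = Multiplicative.ofAdd 0 := by
  change Multiplicative.ofAdd (shiftBot elA - shiftTop elA) = _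
  rw [shiftBot_elA, shiftTop_elA, sub_self]

lemma chiB_elB : chiB elB = Multiplicative.ofAdd 1 := by
  change Multiplicative.ofAdd (shiftBot elB - shiftTop elB) = _
  rw [shiftBot_elB, shiftTop_elB, zero_sub, neg_neg]

/-! ## The action on dyadic rationals -/

/-- A real number is a dyadic rational. -/
def IsDyadic (x : ℝ) : Prop := ∃ (m : ℤ) (n : ℕ), x = m / 2 ^ n

lemma IsDyadic.add_int {x : ℝ} (h : IsDyadic x) (c : ℤ) : IsDyadic (x + c) := by
  obtain ⟨m, n, rfl⟩ := h
  refine ⟨m + c * 2 ^ n, n, ?_⟩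
  push_cast
  field_simp

lemma IsDyadic.half {x : ℝ} (h : IsDyadic x) : IsDyadic (x / 2) := by
  obtain ⟨m, n, rfl⟩ := h
  exact ⟨m, n + 1, by rw [pow_succ, div_div]⟩

lemma IsDyadic.double {x : ℝ} (h : IsDyadic x) : IsDyadic (2 * x) := by
  obtain ⟨m, n, rfl⟩ := h
  exact ⟨2 * m, n, by push_cast; ring⟩

lemma isDyadic_add_int_iff {x : ℝ} (c : ℤ) : IsDyadic (x + c) ↔ IsDyadic x := by
  refine ⟨fun h => ?_, fun h => h.add_int c⟩
  have := h.add_int (-c)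
  simpa using this

lemma isDyadic_half_iff {x : ℝ} : IsDyadic (x / 2) ↔ IsDyadic x := by
  refine ⟨fun h => ?_, fun h => h.half⟩
  have := h.double
  rwa [mul_div_cancel₀ x two_ne_zero] at this

lemma isDyadic_sub_one_iff {x : ℝ} : IsDyadic (x - 1) ↔ IsDyadic x := by
  have := isDyadic_add_int_iff (x := x) (-1)
  simpa [← sub_eq_add_neg] using this

lemma isDyadic_toFun (g : FTilde) (x : ℝ) : IsDyadic (toFun g x) ↔ IsDyadic x := by
  obtain ⟨g, hg⟩ := g
  change IsDyadic (g x) ↔ _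
  induction hg using Subgroup.closure_induction generalizing x with
  | mem g hg =>
    rcases hg with rfl | rfl
    · exact isDyadic_sub_one_iff
    · rw [genB_apply]
      split_ifs
      · exact Iff.rfl
      · exact isDyadic_half_iff
      · exact isDyadic_sub_one_iff
  | one => exact Iff.rfl
  | mul f g _ _ hf hg => exact (hf (g x)).trans (hg x)
  | inv f _ hf =>
    have := hf (f⁻¹ x)
    rw [show f (f⁻¹ x) = x from f.apply_symm_apply x] at this
    exact this.symm

/-- The dyadic rationals, the vertex set of the Schreier graph. -/
abbrev Vertex : Type := {x : ℝ // IsDyadic x}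

/-- The right action `x.g = g x` on the dyadic rationals. -/
def act (x : Vertex) (g : FTilde) : Vertex := ⟨toFun g x.1, (isDyadic_toFun g x.1).2 x.2⟩

lemma act_mul (x : Vertex) (f g : FTilde) : act x (f * g) = act (act x f) g := rfl

lemma act_one (x : Vertex) : act x 1 = x := rfl

/-- The dyadic rational `x + c`. -/
def translate (x : Vertex) (c : ℤ) : Vertex := ⟨x.1 + c, x.2.add_int c⟩

/-! ## The Schreier graph, its ends and its skeleton -/

/-- The symmetric generating set. -/
def genSet : Set FTilde := {elA, elB, elA⁻¹, elB⁻¹}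

lemma inv_mem_genSet {g : FTilde} (h : g ∈ genSet) : g⁻¹ ∈ genSet := by
  rcases h with rfl | rfl | rfl | rfl <;> simp [genSet]

/-- The Schreier graph on the dyadic rationals. Loops and multiplicities of edges are dropped;
they are irrelevant for the ends. -/
def schreier : SimpleGraph Vertex where
  Adj x y := x ≠ y ∧ ∃ g ∈ genSet, act x g = y
  symm := ⟨by
    rintro x y ⟨hne, g, hg, rfl⟩
    exact ⟨hne.symm, g⁻¹, inv_mem_genSet hg, by rw [← act_mul, mul_inv_cancel, act_one]⟩⟩
  loopless := ⟨fun x h => h.1 rfl⟩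

/-- The ends of the Schreier graph: compatible choices of a component of the complement of every
finite set of vertices. -/
def Ends : Type := ↥(SimpleGraph.end schreier)

/-- The component of the complement of the finite set `K` chosen by the end `ω`. -/
def Ends.comp (ω : Ends) (K : Finset Vertex) : schreier.ComponentCompl (K : Set Vertex) :=
  ω.1 (Opposite.op K)

/-- The topology of the space of ends: the one induced by the maps `ω ↦ ω.comp K` to discrete
spaces, i.e. the inverse limit topology. -/
instance : TopologicalSpace Ends :=
  TopologicalSpace.induced (fun ω => ω.comp)
    (@Pi.topologicalSpace (Finset Vertex)
      (fun K => schreier.ComponentCompl (K : Set Vertex)) (fun _ => ⊥))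

/-- The Borel σ-algebra of the space of ends. -/
instance : MeasurableSpace Ends := borel Ends

instance : BorelSpace Ends := ⟨rfl⟩

/-- A sequence of vertices converges to the end `ω`: for every finite set `K` it eventually stays
in the component of the complement of `K` chosen by `ω`. -/
def ConvergesToEnd (x : ℕ → Vertex) (ω : Ends) : Prop :=
  ∀ K : Finset Vertex, ∀ᶠ n in atTop, x n ∈ (ω.comp K).supp

lemma ConvergesToEnd.unique {x : ℕ → Vertex} {ω ω' : Ends} (h : ConvergesToEnd x ω)
    (h' : ConvergesToEnd x ω') : ω = ω' := by
  apply Subtype.ext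
  funext K
  obtain ⟨n, ⟨_, h1⟩, ⟨_, h2⟩⟩ := ((h K.unop).and (h' K.unop)).exists
  exact h1.symm.trans h2

/-- The ends of negative type: the limits of the rays `x - 1, x - 2, …`, where `x` runs over
the dyadic rationals in `(0, 1]`. -/
def endsMinus : Set Ends :=
  {ω | ∃ x : Vertex, 0 < x.1 ∧ x.1 ≤ 1 ∧ ConvergesToEnd (fun n => translate x (-(n : ℤ))) ω}

/-- The ends of positive type: the limits of the rays `x + 1, x + 2, …`, where `x` runs over
the dyadic rationals in `[1, 2)`. -/
def endsPlus : Set Ends :=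
  {ω | ∃ x : Vertex, 1 ≤ x.1 ∧ x.1 < 2 ∧ ConvergesToEnd (fun n => translate x (n : ℤ)) ω}

/-- The vertices of the skeleton: all those that belong neither to a ray of negative type
(these fill `(-∞, 0]`) nor to a ray of positive type (these fill `[2, ∞)`). -/
def skeletonVertices : Set Vertex := {x | 0 < x.1 ∧ x.1 < 2}

/-- The skeleton: what remains of the Schreier graph after all the rays have been removed. -/
def skeleton : SimpleGraph ↥skeletonVertices := schreier.induce skeletonVertices

/-- The skeleton vertices that belong to a finite set of vertices. -/
def skeletonPart (K : Finset Vertex) : Finset ↥skeletonVertices :=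
  K.preimage Subtype.val Subtype.val_injective.injOn

/-- The ends of the skeleton, as ends of the Schreier graph: `ω` is the image of the end `η` of
the skeleton if for each finite set `K` of vertices, the component of the skeleton without `K`
chosen by `η` lies in the component of the Schreier graph without `K` chosen by `ω`. -/
def endsSkeleton : Set Ends :=
  {ω | ∃ η ∈ SimpleGraph.end skeleton, ∀ K : Finset Vertex, ∀ y : ↥skeletonVertices,
    y ∈ SimpleGraph.ComponentCompl.supp (K := (skeletonPart K : Set ↥skeletonVertices))
      (η (Opposite.op (skeletonPart K))) → y.1 ∈ (ω.comp K).supp}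

/-! ### The space of ends is not empty -/

/-- The vertex `-n`. -/
def negVertex (n : ℕ) : Vertex := ⟨-n, -n, 0, by simp⟩

lemma negVertex_adj (n : ℕ) : schreier.Adj (negVertex n) (negVertex (n + 1)) := by
  refine ⟨fun h => ?_, elA, by simp [genSet], ?_⟩
  · have := congrArg Subtype.val h
    simp [negVertex] at this
  · apply Subtype.ext
    change genA _ = _
    rw [genA_apply]
    simp [negVertex]
    ring

lemma exists_negVertex_notMem (K : Finset Vertex) : ∃ n, ∀ m, n ≤ m → negVertex m ∉ K := by
  have hinj : Function.Injective negVertex := fun a b h => by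
    have := congrArg Subtype.val h
    simpa [negVertex] using this
  have hfin : (negVertex ⁻¹' (K : Set Vertex)).Finite := K.finite_toSet.preimage hinj.injOn
  obtain ⟨n, hn⟩ := hfin.bddAbove
  exact ⟨n + 1, fun m hm hmem => by
    have : m ≤ n := hn (show m ∈ _ from hmem)
    omega⟩

lemma negVertex_comp {K : Finset Vertex} {n : ℕ} (hn : ∀ m, n ≤ m → negVertex m ∉ K) (m : ℕ)
    (hm : n ≤ m) : schreier.componentComplMk (K := (K : Set Vertex)) (hn m hm) =
      schreier.componentComplMk (K := (K : Set Vertex)) (hn n le_rfl) := by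
  induction m, hm using Nat.le_induction with
  | base => rfl
  | succ m hm ih =>
    rw [← ih]
    exact (schreier.componentComplMk_eq_of_adj _ _ (negVertex_adj m)).symm

instance : Nonempty Ends := by
  choose n hn using exists_negVertex_notMem
  refine ⟨⟨fun K => schreier.componentComplMk (K := (K.unop : Set Vertex))
    (hn K.unop _ le_rfl), ?_⟩⟩
  intro L K f
  have hKL : (K.unop : Set Vertex) ⊆ (L.unop : Set Vertex) := CategoryTheory.le_of_op_hom f
  change SimpleGraph.ComponentCompl.hom hKL
      (schreier.componentComplMk (K := (L.unop : Set Vertex)) (hn L.unop _ le_rfl)) =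
    schreier.componentComplMk (K := (K.unop : Set Vertex)) (hn K.unop _ le_rfl)
  rw [← negVertex_comp (hn K.unop) (max (n K.unop) (n L.unop)) (le_max_left _ _)]
  have h := negVertex_comp (hn L.unop) (max (n K.unop) (n L.unop)) (le_max_right _ _)
  have h2 := congrArg (SimpleGraph.ComponentCompl.hom hKL) h
  exact h2.symm

/-! ## The random walk and the limit end field -/

/-- The positions `g_n = h_0 ⋯ h_{n-1}` of the walk issued from the identity, in terms of its
increments. -/
def positions (h : ℕ → FTilde) : ℕ → FTilde
  | 0 => 1
  | n + 1 => positions h n * h n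

lemma measurable_positions : Measurable positions := by
  refine measurable_pi_lambda _ fun n => ?_
  induction n with
  | zero => exact measurable_const
  | succ n ih =>
    have h : Measurable fun p : FTilde × FTilde => p.1 * p.2 := measurable_of_countable _
    exact h.comp (ih.prodMk (measurable_pi_apply n))

/-- The measure on the space of sample paths of the right random walk with step distribution `μ`
issued from the identity. -/
def pathMeasure (μ : PMF FTilde) : Measure (ℕ → FTilde) :=
  (Measure.infinitePi fun _ : ℕ => μ.toMeasure).map positions

instance (μ : PMF FTilde) : IsProbabilityMeasure (pathMeasure μ) :=
  Measure.isProbabilityMeasure_map measurable_positions.aemeasurable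

/-- The limit end of a sequence of vertices (an arbitrary end if the sequence diverges). -/
def limitEnd (x : ℕ → Vertex) : Ends := Classical.epsilon fun ω => ConvergesToEnd x ω

/-- The end field of a sample path: the value at `x` is the limit of `x.g_n`. -/
def endField (g : ℕ → FTilde) : Vertex → Ends := fun x => limitEnd fun n => act x (g n)

/-- The law of the limit end field, a measure on the configurations with values in the ends. -/
def limitMeasure (μ : PMF FTilde) : Measure (Vertex → Ends) := (pathMeasure μ).map endField

/-- The configurations on the Schreier graph with values in `A`. -/
def endFields (A : Set Ends) : Set (Vertex → Ends) := {φ | ∀ x, φ x ∈ A}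

/-- The barycentre of a (finitely supported) probability measure on `ℤ`. -/
def barycentre (p : PMF ℤ) : ℝ := ∑' k : ℤ, (p k).toReal * k

/-- The image of `μ` under a homomorphism to `ℤ`. -/
def imageMeasure (χ : FTilde →* Multiplicative ℤ) (μ : PMF FTilde) : PMF ℤ :=
  μ.map fun g => (χ g).toAdd

end

end ThompsonEnds
/-!
The walk on the Schreier graph is transient, because a ping-pong pair makes the Dirichlet energy
control the values of a function at points. A step of the walk from a vertex far out does not change
the component of the complement of a given finite set, so every transient path converges to an end.

Near `-∞` and `+∞` a step is a translation, of mean `-α` and `-(α + β)` respectively. If one of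
these drifts points outwards, then the walk has a bounded superharmonic function
`min 1 (exp (θ * p))`, with `p` affine in the position, and visits `[-M, M]` only finitely often;
from then on it moves along a single ray. If a drift is zero or points inwards, the sums of the
translation lengths are unbounded in the inward direction, so that no path stays on the rays of
that side. If this holds on both sides, a path visits every orbit of the integer translations only
finitely often: after its last visit to the part of the orbit in `[-M, M]` it could leave neither
the orbit nor that side of the line. The retractions of its positions to the skeleton thus tend to
an end of the skeleton.
-/

namespace ThompsonEnds

open ProbabilityTheory Topology
open scoped RightActions

lemma toReal_pos_of_mem_support {α : Type*} {μ : PMF α} {a : α} (ha : a ∈ μ.support) :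
    0 < (μ a).toReal :=
  ENNReal.toReal_pos ha (μ.apply_ne_top a)

lemma sum_toReal_support_eq_one {α : Type*} {μ : PMF α} (hfin : μ.support.Finite) :
    ∑ a ∈ hfin.toFinset, (μ a).toReal = 1 := by
  have h : ∑ a ∈ hfin.toFinset, μ a = 1 := by
    rw [← μ.tsum_coe]
    exact (tsum_eq_sum fun a ha => by simpa using ha).symm
  rw [← ENNReal.toReal_sum fun a _ => μ.apply_ne_top a, h, ENNReal.toReal_one]

/-! ## The Markov operator of a random walk -/

section RightAction

variable {G X : Type*} [Group G] [MulAction Gᵐᵒᵖ X] {μ : PMF G}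

/-- The Markov operator of the random walk with step distribution `μ` on a space on which the
group acts from the right: the value of `markovOp hfin φ` at `x` is the expectation of `φ` after
one step from `x`. -/
noncomputable def markovOp (hfin : μ.support.Finite) : Module.End ℝ (X → ℝ) :=
  ∑ g ∈ hfin.toFinset, (μ g).toReal • LinearMap.funLeft ℝ ℝ (· <• g)

variable {hfin : μ.support.Finite}

lemma markovOp_apply (φ : X → ℝ) (x : X) :
    markovOp hfin φ x = ∑ g ∈ hfin.toFinset, (μ g).toReal * φ (x <• g) := by
  simp [markovOp, LinearMap.sum_apply, LinearMap.funLeft_apply]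

lemma markovOp_mono {φ ψ : X → ℝ} (h : φ ≤ ψ) : markovOp hfin φ ≤ markovOp hfin ψ := by
  intro x
  simp only [markovOp_apply]
  exact Finset.sum_le_sum fun g _ => mul_le_mul_of_nonneg_left (h _) ENNReal.toReal_nonneg

lemma markovOp_one : markovOp hfin (1 : X → ℝ) = 1 := by
  ext x
  simp [markovOp_apply, sum_toReal_support_eq_one hfin]

lemma abs_markovOp_le {φ : X → ℝ} {C : ℝ} (h : ∀ x, |φ x| ≤ C) (x : X) :
    |markovOp hfin φ x| ≤ C := by
  rw [markovOp_apply]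
  calc |∑ g ∈ hfin.toFinset, (μ g).toReal * φ (x <• g)|
      ≤ ∑ g ∈ hfin.toFinset, (μ g).toReal * C := by
        refine (Finset.abs_sum_le_sum_abs _ _).trans (Finset.sum_le_sum fun g _ => ?_)
        rw [abs_mul, abs_of_nonneg ENNReal.toReal_nonneg]
        exact mul_le_mul_of_nonneg_left (h _) ENNReal.toReal_nonneg
    _ = C := by rw [← Finset.sum_mul, sum_toReal_support_eq_one hfin, one_mul]

lemma markovOp_pow_mono {φ ψ : X → ℝ} (h : φ ≤ ψ) (n : ℕ) :
    (markovOp hfin ^ n) φ ≤ (markovOp hfin ^ n) ψ := by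
  induction n with
  | zero => exact h
  | succ n ih => simpa only [pow_succ', Module.End.mul_apply] using markovOp_mono ih

lemma markovOp_pow_nonneg {φ : X → ℝ} (h : 0 ≤ φ) (n : ℕ) : 0 ≤ (markovOp hfin ^ n) φ := by
  simpa using markovOp_pow_mono h n

lemma markovOp_pow_one (n : ℕ) : (markovOp hfin ^ n) (1 : X → ℝ) = 1 := by
  induction n with
  | zero => rfl
  | succ n ih => rw [pow_succ', Module.End.mul_apply, ih, markovOp_one]

lemma markovOp_pow_le_self {φ : X → ℝ} (h : markovOp hfin φ ≤ φ) (n : ℕ) :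
    (markovOp hfin ^ n) φ ≤ φ := by
  induction n with
  | zero => exact le_rfl
  | succ n ih =>
    rw [pow_succ', Module.End.mul_apply]
    exact (markovOp_mono ih).trans h

lemma exists_mul_le_markovOp_pow (hgen : Subsemigroup.closure μ.support = ⊤) (g : G) :
    ∃ (k : ℕ) (c : ℝ), 0 < c ∧ ∀ ψ : X → ℝ, 0 ≤ ψ → ∀ x,
      c * ψ (x <• g) ≤ (markovOp hfin ^ k) ψ x := by
  induction g using Subsemigroup.dense_induction μ.support hgen with
  | mem g hg =>
    refine ⟨1, (μ g).toReal, toReal_pos_of_mem_support hg, fun ψ hψ x => ?_⟩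
    rw [pow_one, markovOp_apply]
    exact Finset.single_le_sum (f := fun h => (μ h).toReal * ψ (x <• h))
      (fun h _ => mul_nonneg ENNReal.toReal_nonneg (hψ _)) (hfin.mem_toFinset.2 hg)
  | mul f g hf hg =>
    obtain ⟨k, c, hc, hk⟩ := hf
    obtain ⟨l, d, hd, hl⟩ := hg
    refine ⟨k + l, c * d, mul_pos hc hd, fun ψ hψ x => ?_⟩
    calc c * d * ψ (x <• (f * g)) = c * (d * ψ (x <• f <• g)) := by
          rw [mul_assoc, MulOpposite.op_mul, mul_smul]
      _ ≤ c * (markovOp hfin ^ l) ψ (x <• f) := mul_le_mul_of_nonneg_left (hl ψ hψ _) hc.le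
      _ ≤ (markovOp hfin ^ (k + l)) ψ x := by
        rw [pow_add, Module.End.mul_apply]
        exact hk _ (markovOp_pow_nonneg hψ l) x

/-- The expected number of visits to the set `T` at times before `N`, as a function of the
starting point. -/
noncomputable def expectedVisits (hfin : μ.support.Finite) (T : Set X) (N : ℕ) : X → ℝ :=
  ∑ n ∈ Finset.range N, (markovOp hfin ^ n) (T.indicator 1)

lemma expectedVisits_apply (T : Set X) (N : ℕ) (x : X) :
    expectedVisits hfin T N x = ∑ n ∈ Finset.range N, (markovOp hfin ^ n) (T.indicator 1) x :=
  Finset.sum_apply _ _ _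

lemma markovOp_pow_indicator_nonneg (T : Set X) (n : ℕ) :
    0 ≤ (markovOp hfin ^ n) (T.indicator 1) :=
  markovOp_pow_nonneg (Set.indicator_nonneg fun _ _ => zero_le_one) n

lemma expectedVisits_nonneg (T : Set X) (N : ℕ) : 0 ≤ expectedVisits hfin T N :=
  Finset.sum_nonneg fun n _ => markovOp_pow_indicator_nonneg T n

lemma expectedVisits_sub_markovOp_le (T : Set X) (N : ℕ) :
    expectedVisits hfin T N - markovOp hfin (expectedVisits hfin T N) ≤ T.indicator 1 := by
  have h := Finset.sum_range_sub' (fun n => (markovOp hfin ^ n) (T.indicator 1)) N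
  simp only [pow_succ', Module.End.mul_apply, pow_zero, Module.End.one_apply] at h
  rw [expectedVisits, map_sum, ← Finset.sum_sub_distrib, h]
  exact sub_le_self _ (markovOp_pow_indicator_nonneg T N)

lemma sum_range_sub_shift_le {a : ℕ → ℝ} (h0 : ∀ n, 0 ≤ a n) (h1 : ∀ n, a n ≤ 1) (k N : ℕ) :
    ∑ n ∈ Finset.range N, (a n - a (n + k)) ≤ k := by
  calc ∑ n ∈ Finset.range N, (a n - a (n + k))
      = ∑ n ∈ Finset.range k, (a n - a (N + n)) := by
        have h := Finset.sum_range_add a N k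
        rw [add_comm N k, Finset.sum_range_add a k N] at h
        simp only [Finset.sum_sub_distrib, add_comm _ k]
        linarith
    _ ≤ ∑ n ∈ Finset.range k, 1 :=
        Finset.sum_le_sum fun n _ => (sub_le_self _ (h0 _)).trans (h1 n)
    _ = k := by simp

lemma exists_expectedVisits_le_of_superharmonic (hgen : Subsemigroup.closure μ.support = ⊤)
    {φ : X → ℝ} (h0 : 0 ≤ φ) (h1 : φ ≤ 1) (hφ : markovOp hfin φ ≤ φ) {T : Set X}
    (hT : ∀ x ∈ T, φ x = 1) {g : G} {δ : ℝ} (hδ : 0 < δ) (hg : ∀ x ∈ T, φ (x <• g) ≤ 1 - δ) :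
    ∃ C : ℝ, ∀ N x, expectedVisits hfin T N x ≤ C := by
  obtain ⟨k, c, hc, hk⟩ := exists_mul_le_markovOp_pow (X := X) (hfin := hfin) hgen g
  have hdrop : (markovOp hfin ^ k) φ ≤ φ - (c * δ) • T.indicator 1 := by
    intro x
    by_cases hx : x ∈ T
    · have h2 := hk (1 - φ) (sub_nonneg.2 h1) x
      have h3 := mul_le_mul_of_nonneg_left (hg x hx) hc.le
      simp only [map_sub, markovOp_pow_one, Pi.sub_apply, Pi.one_apply, Pi.smul_apply,
        smul_eq_mul, Set.indicator_of_mem hx, hT x hx] at h2 ⊢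
      linarith
    · simpa [hx] using markovOp_pow_le_self hφ k x
  refine ⟨k / (c * δ), fun N x => ?_⟩
  rw [le_div_iff₀ (mul_pos hc hδ), mul_comm, expectedVisits_apply, Finset.mul_sum]
  refine le_trans (Finset.sum_le_sum fun n _ => ?_) (sum_range_sub_shift_le
    (a := fun n => (markovOp hfin ^ n) φ x) (fun n => markovOp_pow_nonneg h0 n x)
    (fun n => (markovOp_pow_le_self hφ n x).trans (h1 x)) k N)
  have h4 := markovOp_pow_mono (hfin := hfin) hdrop n x
  simp only [map_sub, map_smul, ← Module.End.mul_apply, ← pow_add, Pi.sub_apply, Pi.smul_apply,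
    smul_eq_mul] at h4
  linarith

end RightAction

/-! ## Energy and transience -/

section Energy

variable {G X : Type*} [Group G] [MulAction Gᵐᵒᵖ X] {μ : PMF G} {u : X → ℝ}

/-- The energy of a function along a single group element `g`: the squared `ℓ²`-norm of the
difference between `u` and its translate by `g`. -/
noncomputable def shiftEnergy (g : G) (u : X → ℝ) : ℝ := ∑' x, (u x - u (x <• g)) ^ 2

/-- The energy of a function: the mean of its energies along the steps of the random walk. -/
noncomputable def energy (hfin : μ.support.Finite) (u : X → ℝ) : ℝ :=
  ∑ g ∈ hfin.toFinset, (μ g).toReal * shiftEnergy g u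

lemma hasFiniteSupport_comp_smul (hu : u.HasFiniteSupport) (g : G) :
    (fun x => u (x <• g)).HasFiniteSupport :=
  hu.fun_comp_of_injective (MulAction.injective (MulOpposite.op g))

lemma tsum_comp_smul (v : X → ℝ) (g : G) : ∑' x, v (x <• g) = ∑' x, v x :=
  (MulAction.toPerm (MulOpposite.op g)).tsum_eq v

lemma summable_sq (hu : u.HasFiniteSupport) : Summable fun x => u x ^ 2 :=
  summable_of_hasFiniteSupport (by simpa only [sq] using hu.fun_mul_left u)

lemma summable_sq_sub_sq (hu : u.HasFiniteSupport) (f g : G) :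
    Summable fun x => (u (x <• f) - u (x <• g)) ^ 2 :=
  summable_sq ((hasFiniteSupport_comp_smul hu f).fun_sub (hasFiniteSupport_comp_smul hu g))

lemma summable_shiftEnergy (hu : u.HasFiniteSupport) (g : G) :
    Summable fun x => (u x - u (x <• g)) ^ 2 :=
  summable_sq (hu.fun_sub (hasFiniteSupport_comp_smul hu g))

lemma shiftEnergy_nonneg (g : G) (u : X → ℝ) : 0 ≤ shiftEnergy g u :=
  tsum_nonneg fun _ => sq_nonneg _

lemma sq_sub_le_shiftEnergy (hu : u.HasFiniteSupport) (g : G) (x : X) :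
    (u x - u (x <• g)) ^ 2 ≤ shiftEnergy g u :=
  (summable_shiftEnergy hu g).le_tsum x fun _ _ => sq_nonneg _

lemma shiftEnergy_mul_le (hu : u.HasFiniteSupport) (f g : G) :
    shiftEnergy (f * g) u ≤ 2 * shiftEnergy f u + 2 * shiftEnergy g u := by
  have hf := (summable_shiftEnergy hu f).mul_left 2
  have hg := (summable_sq_sub_sq hu f (f * g)).mul_left 2
  have hshift : shiftEnergy g u = ∑' x, (u (x <• f) - u (x <• (f * g))) ^ 2 := by
    simp only [MulOpposite.op_mul, mul_smul]
    exact (tsum_comp_smul (fun x => (u x - u (x <• g)) ^ 2) f).symm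
  rw [hshift, shiftEnergy, shiftEnergy, ← tsum_mul_left, ← tsum_mul_left, ← hf.tsum_add hg]
  refine (summable_shiftEnergy hu (f * g)).tsum_le_tsum (fun x => ?_) (hf.add hg)
  nlinarith [sq_nonneg ((u x - u (x <• f)) - (u (x <• f) - u (x <• (f * g))))]

lemma shiftEnergy_eq (hu : u.HasFiniteSupport) (g : G) :
    shiftEnergy g u = 2 * ∑' x, u x * (u x - u (x <• g)) := by
  have hsq := summable_sq hu
  have hsq' := summable_sq (hasFiniteSupport_comp_smul hu g)
  have hmul : Summable fun x => u x * (u x - u (x <• g)) :=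
    summable_of_hasFiniteSupport (hu.fun_mul_left _)
  calc shiftEnergy g u
      = ∑' x, (2 * (u x * (u x - u (x <• g))) + (u (x <• g) ^ 2 - u x ^ 2)) :=
        tsum_congr fun x => by ring
    _ = 2 * ∑' x, u x * (u x - u (x <• g)) := by
        rw [(hmul.mul_left 2).tsum_add (hsq'.sub hsq), tsum_mul_left, hsq'.tsum_sub hsq,
          tsum_comp_smul (fun x => u x ^ 2), sub_self, add_zero]

variable {hfin : μ.support.Finite}

lemma energy_eq (hu : u.HasFiniteSupport) :
    energy hfin u = 2 * ∑' x, u x * (u x - markovOp hfin u x) := by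
  have hmarkov : ∀ x, u x - markovOp hfin u x =
      ∑ g ∈ hfin.toFinset, (μ g).toReal * (u x - u (x <• g)) := fun x => by
    simp only [markovOp_apply, mul_sub, Finset.sum_sub_distrib, ← Finset.sum_mul,
      sum_toReal_support_eq_one, one_mul]
  simp only [hmarkov, Finset.mul_sum, mul_left_comm (u _)]
  rw [Summable.tsum_finsetSum fun g _ =>
    (summable_of_hasFiniteSupport (hu.fun_mul_left _)).mul_left _, Finset.mul_sum]
  refine Finset.sum_congr rfl fun g _ => ?_
  rw [shiftEnergy_eq hu, tsum_mul_left]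
  ring

lemma exists_shiftEnergy_le_energy (hgen : Subsemigroup.closure μ.support = ⊤) (g : G) :
    ∃ C : ℝ, 0 ≤ C ∧ ∀ u : X → ℝ, u.HasFiniteSupport → shiftEnergy g u ≤ C * energy hfin u := by
  induction g using Subsemigroup.dense_induction μ.support hgen with
  | mem g hg =>
    have hpos := toReal_pos_of_mem_support hg
    refine ⟨(μ g).toReal⁻¹, (inv_pos.2 hpos).le, fun u _ => ?_⟩
    rw [inv_mul_eq_div, le_div_iff₀ hpos, mul_comm]
    exact Finset.single_le_sum (f := fun h => (μ h).toReal * shiftEnergy h u)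
      (fun h _ => mul_nonneg ENNReal.toReal_nonneg (shiftEnergy_nonneg _ _))
      (hfin.mem_toFinset.2 hg)
  | mul f g hf hg =>
    obtain ⟨C, hC, hf⟩ := hf
    obtain ⟨D, hD, hg⟩ := hg
    refine ⟨2 * C + 2 * D, by positivity, fun u hu => ?_⟩
    linarith [shiftEnergy_mul_le hu f g, hf u hu, hg u hu]

lemma tsum_indicator_sq_le (hu : u.HasFiniteSupport) (E : Set X) (g : G) :
    ∑' x, E.indicator (fun z => u z ^ 2) x ≤
      3 / 2 * ∑' x, ((· <• g) '' E).indicator (fun z => u z ^ 2) x + 3 * shiftEnergy g u := by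
  have hinj : Function.Injective fun x : X => x <• g := MulAction.injective (MulOpposite.op g)
  have hE := (summable_sq hu).indicator E
  have hgE := ((summable_sq (hasFiniteSupport_comp_smul hu g)).indicator E).mul_left (3 / 2)
  have hshift := (summable_shiftEnergy hu g).mul_left 3
  have himage : ∑' x, ((· <• g) '' E).indicator (fun z => u z ^ 2) x =
      ∑' x, E.indicator (fun x => u (x <• g) ^ 2) x := by
    rw [← tsum_comp_smul _ g]
    exact tsum_congr fun x => Set.indicator_image hinj
  rw [himage, shiftEnergy, ← tsum_mul_left, ← tsum_mul_left, ← hgE.tsum_add hshift]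
  refine hE.tsum_le_tsum (fun x => ?_) (hgE.add hshift)
  by_cases hx : x ∈ E
  · simp only [Set.indicator_of_mem hx]
    nlinarith [sq_nonneg (u (x <• g) - 2 * (u x - u (x <• g)))]
  · simp only [Set.indicator_of_notMem hx]
    nlinarith [sq_nonneg (u x - u (x <• g))]

/-- Ping-pong: two group elements that map `E` into disjoint subsets of `E`, so that the
mass of a function on `E` cannot be nearly invariant under both of them. -/
structure IsPingPongPair (E : Set X) (a b : G) : Prop where
  mapsTo_left : Set.MapsTo (· <• a) E E
  mapsTo_right : Set.MapsTo (· <• b) E E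
  disjoint_image : Disjoint ((· <• a) '' E) ((· <• b) '' E)

lemma IsPingPongPair.sq_le {E : Set X} {a b : G} (h : IsPingPongPair E a b)
    (hu : u.HasFiniteSupport) {x : X} (hx : x ∈ E) :
    u x ^ 2 ≤ 6 * (shiftEnergy a u + shiftEnergy b u) := by
  have hs := fun T : Set X => (summable_sq hu).indicator T
  have hpoint : u x ^ 2 ≤ ∑' y, E.indicator (fun z => u z ^ 2) y := by
    have h := (hs E).le_tsum x fun y _ => Set.indicator_nonneg (fun _ _ => sq_nonneg _) y
    rwa [Set.indicator_of_mem hx] at h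
  have hsplit : ∑' y, ((· <• a) '' E).indicator (fun z => u z ^ 2) y +
      ∑' y, ((· <• b) '' E).indicator (fun z => u z ^ 2) y ≤
        ∑' y, E.indicator (fun z => u z ^ 2) y := by
    refine ((hs _).tsum_add (hs _)).symm.trans_le
      (((hs _).add (hs _)).tsum_le_tsum (fun y => ?_) (hs E))
    have hunion := congrFun (Set.indicator_union_of_disjoint h.disjoint_image fun z => u z ^ 2) y
    exact hunion.symm.trans_le (Set.indicator_le_indicator_of_subset
      (Set.union_subset h.mapsTo_left.image_subset h.mapsTo_right.image_subset)
      (fun _ => sq_nonneg _) y)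
  linarith [tsum_indicator_sq_le hu E a, tsum_indicator_sq_le hu E b]

lemma IsPingPongPair.exists_sq_le_energy [MulAction.IsPretransitive Gᵐᵒᵖ X] {E : Set X} {a b : G}
    (h : IsPingPongPair E a b) (hE : E.Nonempty) (hgen : Subsemigroup.closure μ.support = ⊤)
    (x : X) :
    ∃ C : ℝ, 0 ≤ C ∧ ∀ u : X → ℝ, u.HasFiniteSupport → u x ^ 2 ≤ C * energy hfin u := by
  obtain ⟨y, hy⟩ := hE
  obtain ⟨g, rfl⟩ := MulAction.exists_smul_eq Gᵐᵒᵖ x y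
  obtain ⟨A, hA, ha⟩ := exists_shiftEnergy_le_energy (X := X) (hfin := hfin) hgen a
  obtain ⟨B, hB, hb⟩ := exists_shiftEnergy_le_energy (X := X) (hfin := hfin) hgen b
  obtain ⟨C, hC, hg⟩ := exists_shiftEnergy_le_energy (X := X) (hfin := hfin) hgen g.unop
  refine ⟨12 * (A + B) + 2 * C, by positivity, fun u hu => ?_⟩
  have hgx := sq_sub_le_shiftEnergy hu g.unop x
  rw [MulOpposite.op_unop] at hgx
  nlinarith [h.sq_le hu hy, ha u hu, hb u hu, hg u hu, sq_nonneg (u x - 2 * u (g • x))]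

lemma hasFiniteSupport_markovOp (hu : u.HasFiniteSupport) :
    (markovOp hfin u).HasFiniteSupport := by
  refine (hfin.biUnion fun g _ => hasFiniteSupport_comp_smul hu g).subset fun x hx => ?_
  rw [Function.mem_support, markovOp_apply] at hx
  obtain ⟨g, hg, hne⟩ := Finset.exists_ne_zero_of_sum_ne_zero hx
  exact Set.mem_biUnion (hfin.mem_toFinset.1 hg) (right_ne_zero_of_mul hne)

lemma hasFiniteSupport_expectedVisits {T : Set X} (hT : T.Finite) (N : ℕ) :
    (expectedVisits hfin T N).HasFiniteSupport := by
  have hpow : ∀ n, ((markovOp hfin ^ n) (T.indicator 1)).HasFiniteSupport := fun n => by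
    induction n with
    | zero => exact hT.subset Set.support_indicator_subset
    | succ n ih =>
      rw [pow_succ', Module.End.mul_apply]
      exact hasFiniteSupport_markovOp ih
  simpa only [← expectedVisits_apply] using! Function.HasFiniteSupport.sum hpow (Finset.range N)

lemma energy_expectedVisits_singleton_le (y : X) (N : ℕ) :
    energy hfin (expectedVisits hfin {y} N) ≤ 2 * expectedVisits hfin {y} N y := by
  set u := expectedVisits hfin {y} N
  have hu : u.HasFiniteSupport := hasFiniteSupport_expectedVisits (Set.finite_singleton y) N
  have hy : ∑' x, u x * ({y} : Set X).indicator 1 x = u y := by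
    rw [tsum_eq_single y fun x hx => by simp [hx]]
    simp
  rw [energy_eq hu, ← hy]
  refine mul_le_mul_of_nonneg_left (Summable.tsum_le_tsum (fun x => ?_)
    (summable_of_hasFiniteSupport (hu.fun_mul_left _))
    (summable_of_hasFiniteSupport (hu.fun_mul_left _))) zero_le_two
  exact mul_le_mul_of_nonneg_left (expectedVisits_sub_markovOp_le {y} N x)
    (expectedVisits_nonneg {y} N x)

/-- The Dirichlet principle: the energy dominates the square of `u` at each point, while the energy
of the truncated Green function `u` is at most `2 * u y`; hence `u y` is bounded. -/
theorem IsPingPongPair.exists_expectedVisits_singleton_le [MulAction.IsPretransitive Gᵐᵒᵖ X]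
    {E : Set X} {a b : G} (h : IsPingPongPair E a b) (hE : E.Nonempty)
    (hgen : Subsemigroup.closure μ.support = ⊤) (x y : X) :
    ∃ C : ℝ, ∀ N, expectedVisits hfin {y} N x ≤ C := by
  obtain ⟨C, hC, hy⟩ := h.exists_sq_le_energy (hfin := hfin) hE hgen y
  obtain ⟨D, hD, hx⟩ := h.exists_sq_le_energy (hfin := hfin) hE hgen x
  refine ⟨1 + D * (2 * (C * 2)), fun N => ?_⟩
  have hfs : (expectedVisits hfin {y} N).HasFiniteSupport :=
    hasFiniteSupport_expectedVisits (Set.finite_singleton y) N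
  have henergy := energy_expectedVisits_singleton_le (hfin := hfin) y N
  have hyN : expectedVisits hfin {y} N y ≤ C * 2 := by
    by_contra! hlt
    nlinarith [hy _ hfs, mul_le_mul_of_nonneg_left henergy hC]
  have hxN : expectedVisits hfin {y} N x ^ 2 ≤ D * (2 * (C * 2)) :=
    (hx _ hfs).trans (mul_le_mul_of_nonneg_left (by linarith) hD)
  nlinarith [sq_nonneg (expectedVisits hfin {y} N x - 1)]

end Energy

/-! ## Drift -/

section Drift

variable {G X : Type*} [Group G] [MulAction Gᵐᵒᵖ X] {μ : PMF G} {hfin : μ.support.Finite}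

lemma exists_sum_mul_exp_le_one {ι : Type*} {s : Finset ι} {m f : ι → ℝ} (hm : ∑ i ∈ s, m i = 1)
    (hf : ∑ i ∈ s, m i * f i < 0) :
    ∃ θ : ℝ, 0 < θ ∧ ∑ i ∈ s, m i * Real.exp (θ * f i) ≤ 1 := by
  have hderiv : HasDerivAt (fun θ => ∑ i ∈ s, m i * Real.exp (θ * f i))
      (∑ i ∈ s, m i * f i) 0 := by
    refine HasDerivAt.fun_sum fun i _ => HasDerivAt.const_mul _ ?_
    simpa using ((hasDerivAt_id (0 : ℝ)).mul_const (f i)).exp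
  have hslope := hderiv.tendsto_slope_zero_right.eventually_lt_const hf
  obtain ⟨θ, hlt, hθ⟩ := (hslope.and self_mem_nhdsWithin).exists
  refine ⟨θ, hθ, ?_⟩
  simp only [zero_add, zero_mul, Real.exp_zero, mul_one, hm, smul_eq_mul] at hlt
  linarith [neg_of_mul_neg_right hlt (inv_pos.2 hθ).le]

lemma markovOp_min_one_exp_le {p : X → ℝ} {f : G → ℝ} {θ : ℝ} (hθ : 0 ≤ θ)
    (hsum : ∑ g ∈ hfin.toFinset, (μ g).toReal * Real.exp (θ * f g) ≤ 1)
    (hp : ∀ g ∈ μ.support, ∀ x, p x ≤ 0 → p (x <• g) = p x + f g) :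
    markovOp hfin (fun x => min 1 (Real.exp (θ * p x))) ≤ fun x => min 1 (Real.exp (θ * p x)) := by
  set φ : X → ℝ := fun x => min 1 (Real.exp (θ * p x))
  have hone : markovOp hfin φ ≤ 1 :=
    (markovOp_mono fun _ => min_le_left _ _).trans_eq markovOp_one
  refine fun x => le_min (hone x) ?_
  rcases le_total (p x) 0 with hx | hx
  · calc markovOp hfin φ x
        ≤ ∑ g ∈ hfin.toFinset, Real.exp (θ * p x) * ((μ g).toReal * Real.exp (θ * f g)) := by
          rw [markovOp_apply]
          refine Finset.sum_le_sum fun g hg => ?_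
          rw [mul_left_comm, ← Real.exp_add, ← mul_add, ← hp g (hfin.mem_toFinset.1 hg) x hx]
          exact mul_le_mul_of_nonneg_left (min_le_right _ _) ENNReal.toReal_nonneg
      _ ≤ Real.exp (θ * p x) := by
          rw [← Finset.mul_sum]
          exact mul_le_of_le_one_right (Real.exp_pos _).le hsum
  · exact (hone x).trans (Real.one_le_exp (mul_nonneg hθ hx))

theorem exists_expectedVisits_le_of_drift (hgen : Subsemigroup.closure μ.support = ⊤)
    {p : X → ℝ} {f : G → ℝ} (hf : ∑ g ∈ hfin.toFinset, (μ g).toReal * f g < 0)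
    (hp : ∀ g ∈ μ.support, ∀ x, p x ≤ 0 → p (x <• g) = p x + f g) {T : Set X}
    (hT : ∀ x ∈ T, 0 ≤ p x) {g : G} (hg : ∀ x ∈ T, p (x <• g) ≤ -1) :
    ∃ C : ℝ, ∀ N x, expectedVisits hfin T N x ≤ C := by
  obtain ⟨θ, hθ, hsum⟩ := exists_sum_mul_exp_le_one (sum_toReal_support_eq_one hfin) hf
  have hexp : Real.exp (-θ) < 1 := Real.exp_lt_one_iff.2 (neg_lt_zero.2 hθ)
  refine exists_expectedVisits_le_of_superharmonic hgen
    (fun x => le_min zero_le_one (Real.exp_pos _).le) (fun x => min_le_left _ _)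
    (markovOp_min_one_exp_le hθ.le hsum hp)
    (fun x hx => min_eq_left (Real.one_le_exp (mul_nonneg hθ.le (hT x hx))))
    (sub_pos.2 hexp) (g := g) fun x hx => ?_
  rw [sub_sub_cancel]
  exact (min_le_right _ _).trans (Real.exp_le_exp.2 (by nlinarith [hg x hx]))

end Drift

/-! ## Walks on the integers -/

section IntegerWalk

variable {Ω : Type*} [MeasurableSpace Ω] {P : Measure Ω} {X : ℕ → Ω → ℤ}

lemma ae_frequently_mem {β : Type*} [MeasurableSpace β] {Y : ℕ → Ω → β}
    (hm : ∀ n, Measurable (Y n)) (hindep : iIndepFun Y P)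
    (hident : ∀ n, IdentDistrib (Y 0) (Y n) P P) {s : Set β} (hs : MeasurableSet s)
    (hpos : P (Y 0 ⁻¹' s) ≠ 0) : ∀ᵐ ω ∂P, ∃ᶠ n in atTop, Y n ω ∈ s := by
  have := hindep.isProbabilityMeasure
  have hms : ∀ n, MeasurableSet (Y n ⁻¹' s) := fun n => hm n hs
  have hset : iIndepSet (fun n => Y n ⁻¹' s) P :=
    (iIndepSet_iff_meas_biInter hms).2 fun t => hindep.meas_biInter fun n _ => ⟨s, hs, rfl⟩
  have hsum : ∑' n, P (Y n ⁻¹' s) = ⊤ := by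
    simp_rw [← fun n => (hident n).measure_mem_eq hs]
    exact ENNReal.tsum_const_eq_top_of_ne_zero hpos
  have hae : ∀ᵐ ω ∂P, ω ∈ limsup (fun n => Y n ⁻¹' s) atTop :=
    (prob_compl_eq_zero_iff (MeasurableSet.measurableSet_limsup hms)).2
      (measure_limsup_eq_one hms hset hsum)
  filter_upwards [hae] with ω hω
  rwa [mem_limsup_iff_frequently_mem] at hω

lemma submartingale_sum_natural {Y : ℕ → Ω → ℝ} (hm : ∀ n, StronglyMeasurable (Y n))
    (hindep : iIndepFun Y P) (hint : ∀ n, Integrable (Y n) P) (hmean : ∀ n, 0 ≤ ∫ ω, Y n ω ∂P) :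
    Submartingale (fun n => ∑ i ∈ Finset.range (n + 1), Y i) (Filtration.natural Y hm) P := by
  have := hindep.isProbabilityMeasure
  refine submartingale_of_condExp_sub_nonneg_nat (fun n => ?_)
    (fun n => integrable_finsetSum' _ fun i _ => hint i) fun n => ?_
  · exact Finset.stronglyMeasurable_sum _ fun i hi =>
      (Filtration.stronglyAdapted_natural hm i).mono
        ((Filtration.natural Y hm).mono (Nat.lt_succ_iff.1 (Finset.mem_range.1 hi)))
  · rw [Finset.sum_range_succ _ (n + 1), add_sub_cancel_left]
    filter_upwards [hindep.condExp_natural_ae_eq_of_lt hm (Nat.lt_succ_self n)] with ω hω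
    rw [hω]
    exact hmean (n + 1)

lemma eventually_eq_of_tendsto_intCast {s : ℕ → ℤ} {c : ℝ}
    (h : Tendsto (fun n => (s n : ℝ)) atTop (𝓝 c)) : ∀ᶠ n in atTop, s (n + 1) = s n := by
  have h1 := (h.comp (tendsto_add_atTop_nat 1)).sub h
  rw [sub_self] at h1
  filter_upwards [h1.eventually (Metric.ball_mem_nhds 0 one_pos)] with n hn
  simp only [Function.comp_apply, dist_zero_right, Real.norm_eq_abs] at hn
  have h2 : |s (n + 1) - s n| < 1 := by exact_mod_cast hn
  exact sub_eq_zero.1 (Int.abs_lt_one_iff.1 h2)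

theorem ae_not_bddAbove_sum (hm : ∀ n, Measurable (X n)) (hindep : iIndepFun X P)
    (hident : ∀ n, IdentDistrib (X 0) (X n) P P) {R : NNReal} (hR : ∀ᵐ ω ∂P, |(X 0 ω : ℝ)| ≤ R)
    (hne : P (X 0 ⁻¹' {0}ᶜ) ≠ 0) (hmean : 0 ≤ ∫ ω, (X 0 ω : ℝ) ∂P) :
    ∀ᵐ ω ∂P, ¬ BddAbove (Set.range fun n => ∑ i ∈ Finset.range n, X i ω) := by
  have := hindep.isProbabilityMeasure
  have hcast : Measurable fun k : ℤ => (k : ℝ) := measurable_of_countable _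
  have hmR : ∀ n, StronglyMeasurable fun ω => (X n ω : ℝ) := fun n =>
    (hcast.comp (hm n)).stronglyMeasurable
  have hidentR : ∀ n, IdentDistrib (fun ω => (X 0 ω : ℝ)) (fun ω => (X n ω : ℝ)) P P := fun n =>
    (hident n).comp hcast
  have hbdd : ∀ n, ∀ᵐ ω ∂P, |(X n ω : ℝ)| ≤ R := fun n =>
    (hidentR n).ae_snd (measurableSet_le continuous_abs.measurable measurable_const) hR
  have hsub := submartingale_sum_natural hmR (hindep.comp (fun _ => _) fun _ => hcast)
    (fun n => Integrable.of_bound (hmR n).aestronglyMeasurable R (hbdd n))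
    fun n => (hidentR n).integral_eq ▸ hmean
  have hstep : ∀ᵐ ω ∂P, ∀ n, |(∑ i ∈ Finset.range (n + 1 + 1), fun ω => (X i ω : ℝ)) ω -
      (∑ i ∈ Finset.range (n + 1), fun ω => (X i ω : ℝ)) ω| ≤ R := by
    filter_upwards [ae_all_iff.2 hbdd] with ω hω n
    rw [Finset.sum_range_succ _ (n + 1), Pi.add_apply, add_sub_cancel_left]
    exact hω (n + 1)
  filter_upwards [hsub.bddAbove_iff_exists_tendsto hstep,
    ae_frequently_mem hm hindep hident (measurableSet_singleton 0).compl hne]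
    with ω hconv hfreq ⟨c, hc⟩
  simp only [Finset.sum_apply, ← Int.cast_sum] at hconv
  obtain ⟨l, hl⟩ := hconv.1
    ⟨c, Set.forall_mem_range.2 fun n => Int.cast_le.2 (hc (Set.mem_range_self (n + 1)))⟩
  have hstat := (tendsto_sub_atTop_nat 1).eventually (eventually_eq_of_tendsto_intCast hl)
  refine hfreq ?_
  filter_upwards [hstat, eventually_ge_atTop 1] with n hn h1
  rw [Nat.sub_add_cancel h1, Finset.sum_range_succ, add_eq_left] at hn
  exact not_not.2 hn

end IntegerWalk
/-! ## The action on the dyadic rationals -/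

instance : MulAction FTildeᵐᵒᵖ Vertex where
  smul g x := act x g.unop
  one_smul := act_one
  mul_smul f g x := act_mul x g.unop f.unop

instance : Countable Vertex := by
  have h : {x : ℝ | IsDyadic x} ⊆ Set.range fun p : ℤ × ℕ => (p.1 : ℝ) / 2 ^ p.2 := by
    rintro _ ⟨k, n, rfl⟩
    exact ⟨(k, n), rfl⟩
  exact ((Set.countable_range _).mono h).to_subtype

lemma coe_act (x : Vertex) (g : FTilde) : (act x g : ℝ) = toFun g x := rfl

lemma coe_translate (x : Vertex) (c : ℤ) : (translate x c : ℝ) = x + c := rfl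

lemma toFun_elA (x : ℝ) : toFun elA x = x - 1 := rfl

lemma toFun_elA_inv (x : ℝ) : toFun elA⁻¹ x = x + 1 := rfl

lemma toFun_elB (x : ℝ) :
    toFun elB x = if x ≤ 0 then x else if x ≤ 2 then x / 2 else x - 1 := rfl

lemma toFun_elB_inv (x : ℝ) :
    toFun elB⁻¹ x = if x ≤ 0 then x else if x ≤ 1 then 2 * x else x + 1 := rfl

lemma FTilde.induction {p : FTilde → Prop} (elA : p elA) (elB : p elB) (one : p 1)
    (mul : ∀ f g, p f → p g → p (f * g)) (inv : ∀ g, p g → p g⁻¹) (g : FTilde) : p g := by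
  obtain ⟨g, hg⟩ := g
  induction hg using Subgroup.closure_induction with
  | mem x hx =>
    rcases hx with rfl | rfl
    · exact elA
    · exact elB
  | one => exact one
  | mul f g _ _ hf hg => exact mul _ _ hg hf
  | inv f _ hf => exact inv _ hf

lemma act_act_inv (x : Vertex) (g : FTilde) : act (act x g) g⁻¹ = x := by
  rw [← act_mul, mul_inv_cancel, act_one]

lemma act_inv_act (x : Vertex) (g : FTilde) : act (act x g⁻¹) g = x := by
  rw [← act_mul, inv_mul_cancel, act_one]

lemma act_injective (g : FTilde) : Function.Injective fun x => act x g :=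
  Function.LeftInverse.injective (g := fun x => act x g⁻¹) fun x => act_act_inv x g

lemma tendsto_act_cofinite (g : FTilde) : Tendsto (fun x => act x g) cofinite cofinite :=
  (act_injective g).tendsto_cofinite

lemma translate_zero (x : Vertex) : translate x 0 = x :=
  Subtype.ext (by rw [coe_translate, Int.cast_zero, add_zero])

lemma translate_translate (x : Vertex) (a b : ℤ) :
    translate (translate x a) b = translate x (a + b) :=
  Subtype.ext (by simp only [coe_translate, Int.cast_add, add_assoc])

lemma translate_injective (x : Vertex) : Function.Injective (translate x) := fun a b h => by
  simpa [coe_translate] using congrArg Subtype.val h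

lemma act_elA (x : Vertex) : act x elA = translate x (-1) :=
  Subtype.ext (by
    rw [coe_act, toFun_elA, coe_translate, Int.cast_neg, Int.cast_one, sub_eq_add_neg])

lemma act_elA_inv (x : Vertex) : act x elA⁻¹ = translate x 1 :=
  Subtype.ext (by rw [coe_act, toFun_elA_inv, coe_translate, Int.cast_one])

lemma act_elA_zpow (x : Vertex) (c : ℤ) : act x (elA ^ c) = translate x (-c) := by
  induction c with
  | zero => rw [zpow_zero, act_one, neg_zero, translate_zero]
  | succ n ih => rw [zpow_add_one, act_mul, ih, act_elA, translate_translate, neg_add]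
  | pred n ih =>
    rw [zpow_sub_one, act_mul, ih, act_elA_inv, translate_translate, neg_sub', sub_neg_eq_add]

/-- The vertex `0`. -/
def origin : Vertex := ⟨0, 0, 0, by simp⟩

lemma exists_act_eq_origin (x : Vertex) : ∃ g, act x g = origin := by
  obtain ⟨_, k, n, rfl⟩ := x
  induction n generalizing k with
  | zero => exact ⟨elA ^ k, by rw [act_elA_zpow]; exact Subtype.ext (by simp [translate, origin])⟩
  | succ n ih =>
    set x : Vertex := ⟨(k : ℝ) / 2 ^ (n + 1), k, n + 1, rfl⟩
    obtain ⟨f, hf⟩ := ih (k + (1 - ⌈x.1⌉) * 2 ^ (n + 1))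
    refine ⟨elA ^ (⌈x.1⌉ - 1) * elB⁻¹ * f, ?_⟩
    rw [act_mul, act_mul, act_elA_zpow, neg_sub, ← hf]
    congr 1
    apply Subtype.ext
    have hle := Int.le_ceil x.1
    have hlt := Int.ceil_lt_add_one x.1
    rw [coe_act, coe_translate, toFun_elB_inv]
    push_cast
    rw [if_neg (by linarith), if_pos (by linarith)]
    simp only [x]
    field_simp
    ring

instance : MulAction.IsPretransitive FTildeᵐᵒᵖ Vertex :=
  (MulAction.isPretransitive_iff_base origin).2 fun x => by
    obtain ⟨g, hg⟩ := exists_act_eq_origin x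
    exact ⟨.op g⁻¹, by rw [← hg]; exact act_act_inv x g⟩

/-- The vertices in the open unit interval. -/
def unitVertices : Set Vertex := {x | 0 < x.1 ∧ x.1 < 1}

lemma unitVertices_nonempty : unitVertices.Nonempty :=
  ⟨⟨1 / 2, 1, 1, by norm_num⟩, by norm_num [unitVertices]⟩

lemma coe_act_elB_of_mem_unitVertices {x : Vertex} (hx : x ∈ unitVertices) :
    (act x elB : ℝ) = x.1 / 2 := by
  obtain ⟨h0, h1⟩ := hx
  rw [coe_act, toFun_elB, if_neg (by linarith), if_pos (by linarith)]

lemma coe_act_elA_inv_mul_elB_of_mem_unitVertices {x : Vertex} (hx : x ∈ unitVertices) :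
    (act x (elA⁻¹ * elB) : ℝ) = (x.1 + 1) / 2 := by
  obtain ⟨h0, h1⟩ := hx
  rw [coe_act, toFun_mul, toFun_elA_inv, toFun_elB, if_neg (by linarith), if_pos (by linarith)]

lemma isPingPongPair_unitVertices : IsPingPongPair unitVertices elB (elA⁻¹ * elB) where
  mapsTo_left x hx := by
    have h : (x <• elB : Vertex).1 = x.1 / 2 := coe_act_elB_of_mem_unitVertices hx
    constructor <;> linarith [hx.1, hx.2]
  mapsTo_right x hx := by
    have h : (x <• (elA⁻¹ * elB) : Vertex).1 = (x.1 + 1) / 2 :=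
      coe_act_elA_inv_mul_elB_of_mem_unitVertices hx
    constructor <;> linarith [hx.1, hx.2]
  disjoint_image := by
    rw [Set.disjoint_left]
    rintro _ ⟨x, hx, rfl⟩ ⟨y, hy, hxy⟩
    have h : (y.1 + 1) / 2 = x.1 / 2 := by
      rw [← coe_act_elB_of_mem_unitVertices hx, ← coe_act_elA_inv_mul_elB_of_mem_unitVertices hy]
      exact congrArg Subtype.val hxy
    linarith [hx.2, hy.1]

/-! ## Convergence to ends -/

/-- Two vertices lie in the same component of the complement of `K`. -/
def ConnectedOutside {V : Type*} (G : SimpleGraph V) (K : Set V) (x y : V) : Prop :=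
  ∃ C : G.ComponentCompl K, x ∈ C.supp ∧ y ∈ C.supp

section ConnectedOutside

variable {V : Type*} {G : SimpleGraph V} {K : Set V} {x y z : V}

lemma eq_of_mem_supp {C D : G.ComponentCompl K} (hC : x ∈ C.supp) (hD : x ∈ D.supp) : C = D := by
  obtain ⟨_, hC⟩ := hC
  obtain ⟨_, hD⟩ := hD
  exact hC.symm.trans hD

lemma ConnectedOutside.refl (hx : x ∉ K) : ConnectedOutside G K x x :=
  ⟨G.componentComplMk hx, ⟨hx, rfl⟩, ⟨hx, rfl⟩⟩

lemma ConnectedOutside.symm (h : ConnectedOutside G K x y) : ConnectedOutside G K y x :=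
  let ⟨C, hx, hy⟩ := h
  ⟨C, hy, hx⟩

lemma ConnectedOutside.mem_supp (h : ConnectedOutside G K x y) {C : G.ComponentCompl K}
    (hx : x ∈ C.supp) : y ∈ C.supp := by
  obtain ⟨D, hx', hy⟩ := h
  rwa [eq_of_mem_supp hx hx']

lemma ConnectedOutside.trans (h : ConnectedOutside G K x y) (h' : ConnectedOutside G K y z) :
    ConnectedOutside G K x z :=
  let ⟨C, hx, hy⟩ := h
  ⟨C, hx, h'.mem_supp hy⟩

lemma ConnectedOutside.of_adj (hx : x ∉ K) (hy : y ∉ K) (h : G.Adj x y) :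
    ConnectedOutside G K x y :=
  ⟨G.componentComplMk hx, ⟨hx, rfl⟩, hy, (G.componentComplMk_eq_of_adj hx hy h).symm⟩

lemma ConnectedOutside.componentComplMk_eq (h : ConnectedOutside G K x y) (hx : x ∉ K)
    (hy : y ∉ K) : G.componentComplMk hx = G.componentComplMk hy := by
  obtain ⟨C, ⟨_, hxC⟩, ⟨_, hyC⟩⟩ := h
  exact hxC.trans hyC.symm

lemma ConnectedOutside.exists_walk (h : ConnectedOutside G K x y) :
    ∃ (hx : x ∉ K) (hy : y ∉ K), Nonempty ((G.induce Kᶜ).Walk ⟨x, hx⟩ ⟨y, hy⟩) := by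
  obtain ⟨C, ⟨hx, hxC⟩, ⟨hy, hyC⟩⟩ := h
  exact ⟨hx, hy, SimpleGraph.ConnectedComponent.exact (hxC.trans hyC.symm)⟩

end ConnectedOutside

lemma eventually_connectedOutside_act (K : Finset Vertex) (g : FTilde) :
    ∀ᶠ z in cofinite, ConnectedOutside schreier K z (act z g) := by
  have hK : ∀ᶠ z in cofinite, z ∉ (K : Set Vertex) := K.finite_toSet.compl_mem_cofinite
  have hgen : ∀ g ∈ genSet, ∀ᶠ z in cofinite, ConnectedOutside schreier K z (act z g) := by
    intro g hg
    filter_upwards [hK, (tendsto_act_cofinite g).eventually hK] with z hz hzg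
    by_cases h : z = act z g
    · rw [← h]
      exact .refl hz
    · exact .of_adj hz hzg ⟨h, g, hg, rfl⟩
  induction g using FTilde.induction with
  | elA => exact hgen _ (by simp [genSet])
  | elB => exact hgen _ (by simp [genSet])
  | one => exact hK.mono fun z hz => .refl hz
  | mul f g hf hg =>
    filter_upwards [hf, (tendsto_act_cofinite f).eventually hg] with z hzf hzg
    exact hzf.trans hzg
  | inv g hg =>
    filter_upwards [(tendsto_act_cofinite g⁻¹).eventually hg] with z hz
    rw [act_inv_act] at hz
    exact hz.symm

lemma Ends.hom_comp (ω : Ends) {K L : Finset Vertex} (h : K ⊆ L) :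
    SimpleGraph.ComponentCompl.hom (Finset.coe_subset.2 h) (ω.comp L) = ω.comp K :=
  ω.2 (CategoryTheory.homOfLE h).op

lemma Ends.supp_comp_mono (ω : Ends) {K L : Finset Vertex} (h : K ⊆ L) :
    (ω.comp L).supp ⊆ (ω.comp K).supp := by
  rw [← ω.hom_comp h]
  exact SimpleGraph.ComponentCompl.subset_hom _ _

lemma exists_convergesToEnd_of_eventually_mem {x : ℕ → Vertex}
    (h : ∀ K : Finset Vertex, ∃ C : schreier.ComponentCompl K, ∀ᶠ n in atTop, x n ∈ C.supp) :
    ∃ ω, ConvergesToEnd x ω := by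
  choose C hC using h
  refine ⟨⟨fun K => C K.unop, fun {L K} f => ?_⟩, hC⟩
  have hKL : (K.unop : Set Vertex) ⊆ (L.unop : Set Vertex) := CategoryTheory.le_of_op_hom f
  obtain ⟨n, hL, hK⟩ := ((hC L.unop).and (hC K.unop)).exists
  exact eq_of_mem_supp (SimpleGraph.ComponentCompl.subset_hom (C L.unop) hKL hL) hK

lemma exists_convergesToEnd_of_connectedOutside {x : ℕ → Vertex}
    (h : ∀ K : Finset Vertex, ∀ᶠ n in atTop, ConnectedOutside schreier K (x n) (x (n + 1))) :
    ∃ ω, ConvergesToEnd x ω := by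
  refine exists_convergesToEnd_of_eventually_mem fun K => ?_
  obtain ⟨N, hN⟩ := eventually_atTop.1 (h K)
  obtain ⟨C, hC, -⟩ := hN N le_rfl
  refine ⟨C, eventually_atTop.2 ⟨N, fun n hn => ?_⟩⟩
  induction n, hn using Nat.le_induction with
  | base => exact hC
  | succ n hn ih => exact (hN n hn).mem_supp ih

theorem exists_convergesToEnd_of_tendsto_cofinite {x : ℕ → Vertex}
    (hx : Tendsto x atTop cofinite) {S : Set FTilde} (hS : S.Finite)
    (hstep : ∀ n, ∃ g ∈ S, x (n + 1) = act (x n) g) : ∃ ω, ConvergesToEnd x ω := by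
  refine exists_convergesToEnd_of_connectedOutside fun K => ?_
  have h : ∀ᶠ z in cofinite, ∀ g ∈ S, ConnectedOutside schreier K z (act z g) :=
    (eventually_all_finite hS).2 fun g _ => eventually_connectedOutside_act K g
  filter_upwards [hx.eventually h] with n hn
  obtain ⟨g, hg, hgn⟩ := hstep n
  exact hgn ▸ hn g hg

lemma ConvergesToEnd.comp {x : ℕ → Vertex} {ω : Ends} (h : ConvergesToEnd x ω) {k : ℕ → ℕ}
    (hk : Tendsto k atTop atTop) : ConvergesToEnd (x ∘ k) ω := fun K => hk.eventually (h K)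

lemma ConvergesToEnd.congr {x y : ℕ → Vertex} {ω : Ends} (h : ConvergesToEnd x ω)
    (hxy : x =ᶠ[atTop] y) : ConvergesToEnd y ω := fun K => by
  filter_upwards [h K, hxy] with n hn hxy
  exact hxy ▸ hn

lemma ConvergesToEnd.ray {x : ℕ → Vertex} {ω : Ends} (h : ConvergesToEnd x ω)
    (hx : Tendsto x atTop cofinite) (y : Vertex) (ε : ℤˣ) {j : ℕ → ℕ}
    (hj : ∀ᶠ n in atTop, x n = translate y (ε * j n)) :
    ConvergesToEnd (fun n => translate y (ε * n)) ω := by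
  have hinj : Function.Injective fun n : ℕ => translate y (ε * n) :=
    (translate_injective y).comp ((mul_right_injective₀ ε.ne_zero).comp Nat.cast_injective)
  obtain ⟨ω', hω'⟩ := exists_convergesToEnd_of_tendsto_cofinite
    (Nat.cofinite_eq_atTop ▸ hinj.tendsto_cofinite) (Set.finite_singleton (elA ^ (-ε : ℤ)))
    fun n => ⟨_, rfl, by
      rw [act_elA_zpow, translate_translate, neg_neg, Nat.cast_succ, mul_add_one]⟩
  have hcomp : Tendsto ((fun n : ℕ => translate y (ε * n)) ∘ j) atTop cofinite := hx.congr' hj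
  have hlim : Tendsto j atTop atTop :=
    (tendsto_comap_iff.2 hcomp).mono_right
      ((comap_cofinite_le _).trans Nat.cofinite_eq_atTop.le)
  rwa [h.unique ((hω'.comp hlim).congr (hj.mono fun n hn => hn.symm))]

lemma mem_endsMinus_of_eventually {x : ℕ → Vertex} {ω : Ends} (h : ConvergesToEnd x ω)
    (hx : Tendsto x atTop cofinite) {z : Vertex}
    (hz : ∀ᶠ n in atTop, (x n).1 ≤ 0 ∧ ∃ c : ℤ, x n = translate z c) : ω ∈ endsMinus := by
  have hle := Int.le_ceil z.1
  have hlt := Int.ceil_lt_add_one z.1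
  have hval : (translate z (1 - ⌈z.1⌉)).1 = z + 1 - ⌈z.1⌉ := by
    rw [coe_translate]
    push_cast
    ring
  have hray : ∀ᶠ n in atTop, ∃ k : ℕ,
      x n = translate (translate z (1 - ⌈z.1⌉)) ((-1 : ℤˣ) * k) := by
    filter_upwards [hz] with n ⟨hn, c, hc⟩
    rw [hc, coe_translate] at hn
    have hk : 0 ≤ 1 - ⌈z.1⌉ - c := by
      have : (c : ℝ) < 1 - ⌈z.1⌉ + 1 := by linarith
      have : c < 1 - ⌈z.1⌉ + 1 := by exact_mod_cast this
      omega
    refine ⟨(1 - ⌈z.1⌉ - c).toNat, ?_⟩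
    rw [hc, translate_translate, Int.toNat_of_nonneg hk]
    congr 1
    push_cast
    ring
  obtain ⟨j, hj⟩ := hray.choice
  refine ⟨translate z (1 - ⌈z.1⌉), by linarith, by linarith, ?_⟩
  simpa using h.ray hx _ (-1) hj

lemma mem_endsPlus_of_eventually {x : ℕ → Vertex} {ω : Ends} (h : ConvergesToEnd x ω)
    (hx : Tendsto x atTop cofinite) {z : Vertex}
    (hz : ∀ᶠ n in atTop, 1 ≤ (x n).1 ∧ ∃ c : ℤ, x n = translate z c) : ω ∈ endsPlus := by
  have hle := Int.floor_le z.1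
  have hlt := Int.lt_floor_add_one z.1
  have hval : (translate z (1 - ⌊z.1⌋)).1 = z + 1 - ⌊z.1⌋ := by
    rw [coe_translate]
    push_cast
    ring
  have hray : ∀ᶠ n in atTop, ∃ k : ℕ,
      x n = translate (translate z (1 - ⌊z.1⌋)) ((1 : ℤˣ) * k) := by
    filter_upwards [hz] with n ⟨hn, c, hc⟩
    rw [hc, coe_translate] at hn
    have hk : 0 ≤ c - (1 - ⌊z.1⌋) := by
      have : ((1 - ⌊z.1⌋ - 1 : ℤ) : ℝ) < c := by push_cast; linarith
      have : 1 - ⌊z.1⌋ - 1 < c := by exact_mod_cast this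
      omega
    refine ⟨(c - (1 - ⌊z.1⌋)).toNat, ?_⟩
    rw [hc, translate_translate, Int.toNat_of_nonneg hk]
    congr 1
    push_cast
    ring
  obtain ⟨j, hj⟩ := hray.choice
  refine ⟨translate z (1 - ⌊z.1⌋), by linarith, by linarith, ?_⟩
  simpa using h.ray hx _ 1 hj

/-! ## The skeleton -/

/-- The retraction of the Schreier graph onto its skeleton, contracting each of the rays filling
`(-∞, 0]` and `[2, ∞)` to the skeleton vertex at its start. At most one of the two summands is
nonzero. -/
noncomputable def retract (x : Vertex) : Vertex :=
  translate x (max 0 (1 - ⌈x.1⌉) + min 0 (1 - ⌊x.1⌋))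

lemma retract_of_le_one {x : Vertex} (hx : x.1 ≤ 1) : retract x = translate x (1 - ⌈x.1⌉) := by
  have hceil : ⌈x.1⌉ ≤ 1 := Int.ceil_le.2 (by simpa using hx)
  have hfloor := Int.floor_le_ceil x.1
  rw [retract, max_eq_right (by omega), min_eq_left (by omega), add_zero]

lemma retract_of_one_le {x : Vertex} (hx : 1 ≤ x.1) : retract x = translate x (1 - ⌊x.1⌋) := by
  have hfloor : 1 ≤ ⌊x.1⌋ := Int.le_floor.2 (by simpa using hx)
  have hceil := Int.floor_le_ceil x.1
  rw [retract, max_eq_left (by omega), min_eq_right (by omega), zero_add]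

lemma retract_mem (x : Vertex) : retract x ∈ skeletonVertices := by
  change 0 < (retract x).1 ∧ (retract x).1 < 2
  rcases le_total x.1 1 with hx | hx
  · have hle := Int.le_ceil x.1
    have hlt := Int.ceil_lt_add_one x.1
    rw [retract_of_le_one hx, coe_translate]
    push_cast
    constructor <;> linarith
  · have hle := Int.floor_le x.1
    have hlt := Int.lt_floor_add_one x.1
    rw [retract_of_one_le hx, coe_translate]
    push_cast
    constructor <;> linarith

lemma retract_of_mem {x : Vertex} (hx : x ∈ skeletonVertices) : retract x = x := by
  obtain ⟨hpos, hlt⟩ := hx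
  rcases le_total x.1 1 with hx | hx
  · have hceil : ⌈x.1⌉ = 1 := Int.ceil_eq_iff.2 ⟨by simpa using hpos, by simpa using hx⟩
    rw [retract_of_le_one hx, hceil, sub_self, translate_zero]
  · have hfloor : ⌊x.1⌋ = 1 := Int.floor_eq_iff.2 ⟨by simpa using hx, by norm_num; exact hlt⟩
    rw [retract_of_one_le hx, hfloor, sub_self, translate_zero]

lemma retract_translate_one {x : Vertex} (hx : x.1 ≤ 0 ∨ 1 ≤ x.1) :
    retract (translate x 1) = retract x := by
  rcases hx with hx | hx
  · have hx1 : (translate x 1).1 ≤ 1 := by rw [coe_translate]; push_cast; linarith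
    rw [retract_of_le_one hx1, retract_of_le_one (by linarith), translate_translate,
      coe_translate, Int.ceil_add_intCast]
    congr 1
    ring
  · have hx1 : 1 ≤ (translate x 1).1 := by rw [coe_translate]; push_cast; linarith
    rw [retract_of_one_le hx1, retract_of_one_le hx, translate_translate,
      coe_translate, Int.floor_add_intCast]
    congr 1
    ring

lemma schreier_adj_translate_one (x : Vertex) : schreier.Adj x (translate x 1) := by
  refine ⟨fun h => ?_, elA⁻¹, by simp [genSet], act_elA_inv x⟩
  simpa [coe_translate] using congrArg Subtype.val h

lemma connectedOutside_translate_one {K : Set Vertex} {x : Vertex} (hx : x ∉ K)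
    (hx' : translate x 1 ∉ K) : ConnectedOutside schreier K x (translate x 1) :=
  .of_adj hx hx' (schreier_adj_translate_one x)

/-- The path runs along the ray of `x`, all of whose vertices have the same retraction. -/
lemma connectedOutside_retract {K : Set Vertex} {x : Vertex} (hx : retract x ∉ retract '' K) :
    ConnectedOutside schreier K x (retract x) := by
  have hK : ∀ {y}, retract y ∉ retract '' K → y ∉ K := fun hy h => hy (Set.mem_image_of_mem _ h)
  obtain ⟨n, hn⟩ := exists_nat_gt (|x.1 - 1| - 1)
  induction n generalizing x with
  | zero =>
    have hmem : x ∈ skeletonVertices := by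
      have := abs_lt.1 (show |x.1 - 1| < 1 by push_cast at hn; linarith)
      exact ⟨by linarith, by linarith⟩
    rw [retract_of_mem hmem]
    exact .refl (hK hx)
  | succ n ih =>
    push_cast at hn
    have hdist := abs_lt.1 (show |x.1 - 1| < n + 2 by linarith)
    by_cases hmem : x ∈ skeletonVertices
    · rw [retract_of_mem hmem]
      exact .refl (hK hx)
    rcases le_or_gt x.1 0 with h0 | h0
    · have hr := retract_translate_one (.inl h0)
      rw [← hr] at hx ⊢
      refine (connectedOutside_translate_one (hK (hr ▸ hx)) (hK hx)).trans (ih hx ?_)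
      rw [sub_lt_iff_lt_add, abs_lt, coe_translate]
      push_cast
      constructor <;> linarith [n.cast_nonneg (α := ℝ)]
    · have h2 : 2 ≤ x.1 := not_lt.1 fun h => hmem ⟨h0, h⟩
      obtain ⟨y, rfl⟩ : ∃ y, x = translate y 1 :=
        ⟨translate x (-1), by rw [translate_translate, neg_add_cancel, translate_zero]⟩
      rw [coe_translate] at h2 hdist
      push_cast at h2 hdist
      have hr := retract_translate_one (x := y) (.inr (by linarith))
      rw [hr] at hx ⊢
      refine (connectedOutside_translate_one (hK hx) (hK (hr.symm ▸ hx))).symm.trans (ih hx ?_)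
      rw [sub_lt_iff_lt_add, abs_lt]
      constructor <;> linarith

lemma retract_act_elA_eq_or_mem (x : Vertex) :
    retract (act x elA) = retract x ∨ act x elA ∈ skeletonVertices ∧ x ∈ skeletonVertices := by
  obtain ⟨y, rfl⟩ : ∃ y, x = act y elA⁻¹ := ⟨act x elA, (act_act_inv x elA).symm⟩
  rw [act_inv_act, act_elA_inv]
  by_cases hy : y.1 ≤ 0 ∨ 1 ≤ y.1
  · exact .inl (retract_translate_one hy).symm
  · push Not at hy
    refine .inr ⟨⟨hy.1, by linarith⟩, ?_, ?_⟩ <;> rw [coe_translate] <;> push_cast <;> linarith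

lemma retract_act_elB_eq_or_mem (x : Vertex) :
    retract (act x elB) = retract x ∨ act x elB ∈ skeletonVertices ∧ x ∈ skeletonVertices := by
  have hval : (act x elB).1 = if x.1 ≤ 0 then x.1 else if x.1 ≤ 2 then x.1 / 2 else x.1 - 1 := rfl
  rcases le_or_gt x.1 0 with h0 | h0
  · rw [if_pos h0] at hval
    exact .inl (congrArg retract (Subtype.ext hval))
  rw [if_neg h0.not_ge] at hval
  rcases lt_or_ge x.1 2 with h2 | h2
  · rw [if_pos h2.le] at hval
    refine .inr ⟨⟨?_, ?_⟩, h0, h2⟩ <;> rw [hval] <;> linarith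
  · have hval' : (act x elB).1 = x.1 - 1 := by
      rw [hval]
      split_ifs <;> linarith
    have hx : translate (act x elB) 1 = x :=
      Subtype.ext (by rw [coe_translate, hval']; push_cast; ring)
    rw [← retract_translate_one (x := act x elB) (.inr (by linarith)), hx]
    exact .inl rfl

lemma retract_eq_or_mem_of_adj {x y : Vertex} (h : schreier.Adj x y) :
    retract x = retract y ∨ x ∈ skeletonVertices ∧ y ∈ skeletonVertices := by
  obtain ⟨-, g, rfl | rfl | rfl | rfl, rfl⟩ := h
  · exact (retract_act_elA_eq_or_mem x).imp Eq.symm And.symm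
  · exact (retract_act_elB_eq_or_mem x).imp Eq.symm And.symm
  · simpa only [act_inv_act] using retract_act_elA_eq_or_mem (act x elA⁻¹)
  · simpa only [act_inv_act] using retract_act_elB_eq_or_mem (act x elB⁻¹)

lemma mem_skeletonPart {K : Finset Vertex} {x : ↥skeletonVertices} :
    x ∈ skeletonPart K ↔ x.1 ∈ K := by
  simp [skeletonPart]

lemma connectedOutside_skeleton_retract {K : Finset Vertex} {x y : Vertex}
    (h : ConnectedOutside schreier (K : Set Vertex) x y) (hx : retract x ∉ K) :
    ConnectedOutside skeleton (skeletonPart K : Set ↥skeletonVertices)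
      ⟨retract x, retract_mem x⟩ ⟨retract y, retract_mem y⟩ := by
  obtain ⟨hxK, hyK, ⟨p⟩⟩ := h.exists_walk
  have hwalk : ∀ (v w : ↥(K : Set Vertex)ᶜ) (_ : (schreier.induce (K : Set Vertex)ᶜ).Walk v w),
      retract v.1 ∉ K → ConnectedOutside skeleton (skeletonPart K : Set ↥skeletonVertices)
        ⟨retract v.1, retract_mem v.1⟩ ⟨retract w.1, retract_mem w.1⟩ := by
    intro v w p hv
    induction p with
    | nil => exact .refl (mem_skeletonPart.not.2 hv)
    | @cons v u w hadj _ ih =>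
      have hadj : schreier.Adj v.1 u.1 := hadj
      obtain hr | ⟨hv', hu'⟩ := retract_eq_or_mem_of_adj hadj
      · simp only [hr] at hv ⊢
        exact ih hv
      · have hu : retract u.1 ∉ K := by
          rw [retract_of_mem hu']
          exact u.2
        refine .trans (.of_adj (mem_skeletonPart.not.2 hv) (mem_skeletonPart.not.2 hu) ?_) (ih hu)
        change schreier.Adj (retract v.1) (retract u.1)
        rwa [retract_of_mem hv', retract_of_mem hu']
  exact hwalk _ _ p hx

lemma connectedOutside_skeleton_iff {K : Finset Vertex} {x y : ↥skeletonVertices} :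
    ConnectedOutside skeleton (skeletonPart K : Set ↥skeletonVertices) x y ↔
      ConnectedOutside schreier (K : Set Vertex) x.1 y.1 := by
  refine ⟨fun h => ?_, fun h => ?_⟩
  · obtain ⟨hx, hy, ⟨p⟩⟩ := h.exists_walk
    clear h
    have hwalk : ∀ (v w : ↥(skeletonPart K : Set ↥skeletonVertices)ᶜ)
        (_ : (skeleton.induce (skeletonPart K : Set ↥skeletonVertices)ᶜ).Walk v w),
        ConnectedOutside schreier (K : Set Vertex) v.1.1 w.1.1 := by
      intro v w p
      induction p with
      | @nil v => exact .refl (mem_skeletonPart.not.1 v.2)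
      | @cons v u w hadj _ ih =>
        exact .trans (.of_adj (mem_skeletonPart.not.1 v.2) (mem_skeletonPart.not.1 u.2) hadj) ih
    exact hwalk _ _ p
  · have hx : x.1 ∉ K := h.exists_walk.1
    simpa only [retract_of_mem x.2, retract_of_mem y.2] using
      connectedOutside_skeleton_retract h (by rwa [retract_of_mem x.2])

lemma skeletonPart_image_val [DecidableEq Vertex] (L : Finset ↥skeletonVertices) :
    skeletonPart (L.image Subtype.val) = L := by
  ext z
  simp [mem_skeletonPart]

lemma image_val_skeletonPart_subset [DecidableEq Vertex] (K : Finset Vertex) :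
    (skeletonPart K).image Subtype.val ⊆ K := by
  intro v hv
  obtain ⟨w, hw, rfl⟩ := Finset.mem_image.1 hv
  exact mem_skeletonPart.1 hw

lemma mem_endsSkeleton_of_meets {ω : Ends}
    (h : ∀ K : Finset Vertex, ∃ y ∈ skeletonVertices, y ∈ (ω.comp K).supp) : ω ∈ endsSkeleton := by
  classical
  choose y hy hyω using h
  let s : Finset Vertex → ↥skeletonVertices := fun K => ⟨y K, hy K⟩
  have hs : ∀ {K L : Finset Vertex}, K ⊆ L →
      ConnectedOutside skeleton (skeletonPart K : Set ↥skeletonVertices) (s K) (s L) := fun h =>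
    connectedOutside_skeleton_iff.2 ⟨_, hyω _, ω.supp_comp_mono h (hyω _)⟩
  let e : Finset ↥skeletonVertices → Finset Vertex := fun L => L.image Subtype.val
  have hnotMem : ∀ L : Finset ↥skeletonVertices, s (e L) ∉ (L : Set ↥skeletonVertices) := by
    intro L
    have := (hs (Finset.Subset.refl (e L))).exists_walk.1
    rwa [skeletonPart_image_val] at this
  refine ⟨fun L => skeleton.componentComplMk (hnotMem L.unop), fun {L M} f => ?_, fun K z hz => ?_⟩
  · have hML : M.unop ⊆ L.unop := CategoryTheory.le_of_op_hom f
    have h := hs (Finset.image_subset_image (f := Subtype.val) hML)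
    rw [skeletonPart_image_val] at h
    exact (h.componentComplMk_eq (hnotMem _) fun hL => hnotMem _ (hML hL)).symm
  · have hK := hs (image_val_skeletonPart_subset K)
    rw [skeletonPart_image_val] at hK
    have hz' : ConnectedOutside skeleton (skeletonPart K : Set ↥skeletonVertices)
        (s (e (skeletonPart K))) z := ⟨_, ⟨hnotMem _, rfl⟩, hz⟩
    exact (connectedOutside_skeleton_iff.1 (hK.symm.trans hz')).mem_supp (hyω K)

lemma mem_endsSkeleton_iff {ω : Ends} :
    ω ∈ endsSkeleton ↔ ∀ K : Finset Vertex, ∃ y ∈ skeletonVertices, y ∈ (ω.comp K).supp := by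
  refine ⟨fun ⟨η, _, h⟩ K => ?_, mem_endsSkeleton_of_meets⟩
  obtain ⟨y, hy⟩ := (η (.op (skeletonPart K))).nonempty
  exact ⟨y, y.2, h K y hy⟩

lemma mem_endsSkeleton_of_tendsto_retract {x : ℕ → Vertex} {ω : Ends} (h : ConvergesToEnd x ω)
    (hx : Tendsto (fun n => retract (x n)) atTop cofinite) : ω ∈ endsSkeleton := by
  refine mem_endsSkeleton_iff.2 fun K => ?_
  have hfin : (retract '' (K : Set Vertex)).Finite := K.finite_toSet.image _
  obtain ⟨n, hn, hn'⟩ := ((h K).and (hx.eventually hfin.compl_mem_cofinite)).exists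
  exact ⟨retract (x n), retract_mem _, (connectedOutside_retract hn').mem_supp hn⟩

/-! ## Sample paths -/

section FinitelySupported

variable {α : Type*} [MeasurableSpace α] [MeasurableSingletonClass α] {p : PMF α}

lemma ae_mem_support (p : PMF α) : ∀ᵐ a ∂p.toMeasure, a ∈ p.support := by
  rw [← p.restrict_toMeasure_support]
  exact ae_restrict_mem p.support_countable.measurableSet

lemma integrable_of_finite_support (hfin : p.support.Finite) (f : α → ℝ) :
    Integrable f p.toMeasure := by
  rw [← p.restrict_toMeasure_support]
  exact IntegrableOn.of_finite hfin

lemma integral_eq_sum_support (hfin : p.support.Finite) (f : α → ℝ) :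
    ∫ a, f a ∂p.toMeasure = ∑ a ∈ hfin.toFinset, (p a).toReal * f a := by
  rw [PMF.integral_eq_tsum p f (integrable_of_finite_support hfin f)]
  refine tsum_eq_sum fun a ha => ?_
  have h : p a = 0 := by simpa using ha
  rw [h, ENNReal.toReal_zero, zero_smul]

end FinitelySupported

lemma exists_mem_support_ne_zero {G A : Type*} [Mul G] [AddZeroClass A] {μ : PMF G}
    (hgen : Subsemigroup.closure μ.support = ⊤) {f : G → A} (hf : ∀ g h, f (g * h) = f g + f h)
    {g : G} (hg : f g ≠ 0) : ∃ h ∈ μ.support, f h ≠ 0 := by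
  by_contra! hzero
  suffices h : ∀ g, f g = 0 from hg (h g)
  intro g
  induction g using Subsemigroup.dense_induction μ.support hgen with
  | mem g hg => exact hzero g hg
  | mul g h ihg ihh => rw [hf, ihg, ihh, add_zero]

section RandomWalk

variable {μ : PMF FTilde}

lemma barycentre_imageMeasure (hfin : μ.support.Finite) (χ : FTilde →* Multiplicative ℤ) :
    barycentre (imageMeasure χ μ) =
      ∑ g ∈ hfin.toFinset, (μ g).toReal * ((χ g).toAdd : ℝ) := by
  have hsupp : (imageMeasure χ μ).support.Finite := by
    rw [imageMeasure, PMF.support_map]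
    exact hfin.image _
  have hmeas : Measurable fun g : FTilde => (χ g).toAdd := measurable_of_countable _
  calc barycentre (imageMeasure χ μ)
      = ∫ k : ℤ, (k : ℝ) ∂(imageMeasure χ μ).toMeasure :=
        (PMF.integral_eq_tsum _ _ (integrable_of_finite_support hsupp _)).symm
    _ = ∫ g, ((χ g).toAdd : ℝ) ∂μ.toMeasure := by
        rw [imageMeasure, ← PMF.toMeasure_map _ _ hmeas]
        exact integral_map hmeas.aemeasurable
          (measurable_of_countable _).aestronglyMeasurable
    _ = ∑ g ∈ hfin.toFinset, (μ g).toReal * ((χ g).toAdd : ℝ) := integral_eq_sum_support hfin _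

/-- The law of the increments of the random walk with step distribution `μ`. -/
noncomputable def stepMeasure (μ : PMF FTilde) : Measure (ℕ → FTilde) :=
  Measure.infinitePi fun _ : ℕ => μ.toMeasure

instance (μ : PMF FTilde) : IsProbabilityMeasure (stepMeasure μ) :=
  inferInstanceAs (IsProbabilityMeasure (Measure.infinitePi fun _ : ℕ => μ.toMeasure))

lemma measurePreserving_eval_stepMeasure (μ : PMF FTilde) (n : ℕ) :
    MeasurePreserving (fun h => h n) (stepMeasure μ) μ.toMeasure :=
  ⟨measurable_pi_apply n, Measure.infinitePi_map_eval _ n⟩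

lemma iIndepFun_stepMeasure (μ : PMF FTilde) {β : Type*} [MeasurableSpace β] (f : FTilde → β) :
    iIndepFun (fun (n : ℕ) (h : ℕ → FTilde) => f (h n)) (stepMeasure μ) :=
  iIndepFun_infinitePi (X := fun _ : ℕ => f) fun _ => measurable_from_top

lemma ae_forall_mem_support (μ : PMF FTilde) : ∀ᵐ h ∂stepMeasure μ, ∀ n, h n ∈ μ.support :=
  ae_all_iff.2 fun n =>
    (measurePreserving_eval_stepMeasure μ n).quasiMeasurePreserving.ae (ae_mem_support μ)

lemma ae_not_bddAbove_sum_increments (hfin : μ.support.Finite) {f : FTilde → ℤ}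
    (hf : ∃ g ∈ μ.support, f g ≠ 0)
    (hmean : 0 ≤ ∑ g ∈ hfin.toFinset, (μ g).toReal * (f g : ℝ)) :
    ∀ᵐ h ∂stepMeasure μ, ¬ BddAbove (Set.range fun n => ∑ i ∈ Finset.range n, f (h i)) := by
  have hmeas : Measurable f := measurable_of_countable f
  have heval := measurePreserving_eval_stepMeasure μ
  have hident (n : ℕ) : IdentDistrib (fun h : ℕ → FTilde => f (h 0)) (fun h => f (h n))
      (stepMeasure μ) (stepMeasure μ) :=
    IdentDistrib.comp ⟨(heval 0).aemeasurable, (heval n).aemeasurable,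
      (heval 0).map_eq.trans (heval n).map_eq.symm⟩ hmeas
  obtain ⟨R, hR⟩ := (hfin.image fun g => |(f g : ℝ)|).bddAbove
  have hbound : ∀ᵐ h ∂stepMeasure μ, |(f (h 0) : ℝ)| ≤ R.toNNReal := by
    filter_upwards [ae_forall_mem_support μ] with h hh
    exact (hR ⟨h 0, hh 0, rfl⟩).trans (Real.le_coe_toNNReal R)
  have hne : stepMeasure μ ((fun h => f (h 0)) ⁻¹' {0}ᶜ) ≠ 0 := by
    obtain ⟨g, hg, hne⟩ := hf
    have hpre := (heval 0).measure_preimage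
      (MeasurableSet.of_discrete (s := f ⁻¹' {0}ᶜ)).nullMeasurableSet
    rw [← Set.preimage_comp] at hpre
    refine ne_of_eq_of_ne hpre fun hzero => ?_
    rw [PMF.toMeasure_apply_eq_zero_iff _ MeasurableSet.of_discrete] at hzero
    exact Set.disjoint_left.1 hzero hg hne
  have hint : ∫ h, (f (h 0) : ℝ) ∂stepMeasure μ = ∫ g, (f g : ℝ) ∂μ.toMeasure := by
    rw [← (heval 0).map_eq]
    exact (integral_map (f := fun g => (f g : ℝ)) (heval 0).aemeasurable
      (measurable_of_countable _).aestronglyMeasurable).symm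
  rw [← integral_eq_sum_support hfin, ← hint] at hmean
  exact ae_not_bddAbove_sum (P := stepMeasure μ) (X := fun n h => f (h n)) (R := R.toNNReal)
    (fun n => hmeas.comp (measurable_pi_apply n)) (iIndepFun_stepMeasure μ f) hident hbound hne
    hmean

/-- The walk `x.g_n` on the Schreier graph issued from `x`, in terms of the increments of the
random walk on the group. -/
def trajectory (x : Vertex) (h : ℕ → FTilde) (n : ℕ) : Vertex := act x (positions h n)

lemma trajectory_succ (x : Vertex) (h : ℕ → FTilde) (n : ℕ) :
    trajectory x h (n + 1) = act (trajectory x h n) (h n) := rfl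

lemma measurable_positions_apply (n : ℕ) : Measurable fun h => positions h n :=
  (measurable_pi_apply n).comp measurable_positions

lemma measurableSet_trajectory_mem (x : Vertex) (n : ℕ) (T : Set Vertex) :
    MeasurableSet {h | trajectory x h n ∈ T} :=
  measurable_positions_apply n (MeasurableSet.of_discrete (s := {g : FTilde | act x g ∈ T}))

lemma positions_congr {h h' : ℕ → FTilde} (n : ℕ) (e : ∀ i < n, h i = h' i) :
    positions h n = positions h' n := by
  induction n with
  | zero => rfl
  | succ n ih =>
    rw [positions, positions, ih fun i hi => e i (hi.trans n.lt_succ_self), e n n.lt_succ_self]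

lemma indepFun_positions (μ : PMF FTilde) (n : ℕ) :
    IndepFun (fun h => positions h n) (fun h => h n) (stepMeasure μ) := by
  let extend (t : Finset.range n → FTilde) (i : ℕ) : FTilde :=
    if hi : i ∈ Finset.range n then t ⟨i, hi⟩ else 1
  have hindep := ((iIndepFun_stepMeasure μ id).indepFun_finset (Finset.range n) {n} (by simp)
    fun i => measurable_pi_apply i).comp (φ := fun t => positions (extend t) n)
      (ψ := fun t => t ⟨n, Finset.mem_singleton_self n⟩)
      (measurable_of_countable _) (measurable_of_countable _)
  refine hindep.congr (Eventually.of_forall fun h => ?_) (Eventually.of_forall fun h => rfl)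
  exact positions_congr n fun i hi => dif_pos (Finset.mem_range.2 hi)

lemma integral_trajectory_succ (hfin : μ.support.Finite) {φ : Vertex → ℝ} {C : ℝ}
    (hφ : ∀ z, |φ z| ≤ C) (x : Vertex) (n : ℕ) :
    ∫ h, φ (trajectory x h (n + 1)) ∂stepMeasure μ =
      ∫ h, markovOp hfin φ (trajectory x h n) ∂stepMeasure μ := by
  have hpos := measurable_positions_apply n
  have heval := measurePreserving_eval_stepMeasure μ n
  set ν := (stepMeasure μ).map fun h => positions h n
  have : IsProbabilityMeasure ν := Measure.isProbabilityMeasure_map hpos.aemeasurable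
  have hlaw : (stepMeasure μ).map (fun h => (positions h n, h n)) = ν.prod μ.toMeasure := by
    rw [(indepFun_iff_map_prod_eq_prod_map_map hpos.aemeasurable heval.aemeasurable).1
      (indepFun_positions μ n), heval.map_eq]
  have hmeas : AEStronglyMeasurable (fun p : FTilde × FTilde => φ (act x (p.1 * p.2)))
      (ν.prod μ.toMeasure) := (measurable_of_countable _).aestronglyMeasurable
  calc ∫ h, φ (trajectory x h (n + 1)) ∂stepMeasure μ
      = ∫ p, φ (act x (p.1 * p.2)) ∂ν.prod μ.toMeasure := by
        rw [← hlaw] at hmeas ⊢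
        exact (integral_map (hpos.prodMk heval.measurable).aemeasurable hmeas).symm
    _ = ∫ f, ∫ g, φ (act x (f * g)) ∂μ.toMeasure ∂ν :=
        integral_prod _ (Integrable.of_bound hmeas C (Eventually.of_forall fun p => hφ _))
    _ = ∫ f, markovOp hfin φ (act x f) ∂ν := by
        simp only [integral_eq_sum_support hfin, markovOp_apply]
        rfl
    _ = ∫ h, markovOp hfin φ (trajectory x h n) ∂stepMeasure μ :=
        integral_map hpos.aemeasurable (measurable_of_countable _).aestronglyMeasurable

lemma integral_trajectory (hfin : μ.support.Finite) {φ : Vertex → ℝ} {C : ℝ}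
    (hφ : ∀ z, |φ z| ≤ C) (x : Vertex) (n : ℕ) :
    ∫ h, φ (trajectory x h n) ∂stepMeasure μ = (markovOp hfin ^ n) φ x := by
  induction n generalizing φ with
  | zero => simp [trajectory, positions, act_one]
  | succ n ih =>
    rw [integral_trajectory_succ hfin hφ, ih (abs_markovOp_le hφ), pow_succ, Module.End.mul_apply]

lemma measureReal_trajectory_mem (hfin : μ.support.Finite) (T : Set Vertex) (x : Vertex) (n : ℕ) :
    (stepMeasure μ).real {h | trajectory x h n ∈ T} = (markovOp hfin ^ n) (T.indicator 1) x := by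
  rw [← integral_indicator_one (measurableSet_trajectory_mem x n T),
    ← integral_trajectory hfin (C := 1) fun z => ?_]
  · rfl
  · by_cases hz : z ∈ T <;> simp [hz]

lemma ae_eventually_trajectory_notMem (hfin : μ.support.Finite) {T : Set Vertex} {x : Vertex}
    (h : ∃ C : ℝ, ∀ N, expectedVisits hfin T N x ≤ C) :
    ∀ᵐ h ∂stepMeasure μ, ∀ᶠ n in atTop, trajectory x h n ∉ T := by
  obtain ⟨C, hC⟩ := h
  have hsum : Summable fun n => (stepMeasure μ).real {h | trajectory x h n ∈ T} :=
    summable_of_sum_range_le (fun n => measureReal_nonneg) fun N => by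
      simpa only [measureReal_trajectory_mem hfin, ← expectedVisits_apply] using hC N
  refine MeasureTheory.ae_eventually_notMem (s := fun n => {h | trajectory x h n ∈ T}) ?_
  simp_rw [← fun n => ofReal_measureReal (μ := stepMeasure μ) (s := {h | trajectory x h n ∈ T})]
  rw [← ENNReal.ofReal_tsum_of_nonneg (fun n => measureReal_nonneg) hsum]
  exact ENNReal.ofReal_ne_top

theorem ae_tendsto_cofinite (hfin : μ.support.Finite)
    (hgen : Subsemigroup.closure μ.support = ⊤) :
    ∀ᵐ h ∂stepMeasure μ, ∀ x, Tendsto (trajectory x h) atTop cofinite := by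
  have hne : ∀ᵐ h ∂stepMeasure μ, ∀ x y, ∀ᶠ n in atTop, trajectory x h n ∉ ({y} : Set Vertex) :=
    ae_all_iff.2 fun x => ae_all_iff.2 fun y => ae_eventually_trajectory_notMem hfin
      (isPingPongPair_unitVertices.exists_expectedVisits_singleton_le
        unitVertices_nonempty hgen x y)
  filter_upwards [hne] with h hh x
  exact le_cofinite_iff_eventually_ne.2 fun y => eventually_map.2 (hh x y)

theorem ae_exists_convergesToEnd (hfin : μ.support.Finite)
    (hgen : Subsemigroup.closure μ.support = ⊤) :
    ∀ᵐ h ∂stepMeasure μ, ∀ x, ∃ ω, ConvergesToEnd (trajectory x h) ω := by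
  filter_upwards [ae_forall_mem_support μ, ae_tendsto_cofinite hfin hgen] with h hsupp hcof x
  exact exists_convergesToEnd_of_tendsto_cofinite (hcof x) hfin
    fun n => ⟨h n, hsupp n, trajectory_succ x h n⟩

end RandomWalk

/-! ## Sample paths far from the origin -/

lemma exists_abs_toFun_sub_le (g : FTilde) : ∃ d : ℝ, ∀ x, |toFun g x - x| ≤ d := by
  induction g using FTilde.induction with
  | elA => exact ⟨1, fun x => by simp [toFun_elA]⟩
  | elB =>
    refine ⟨1, fun x => abs_le.2 ?_⟩
    rw [toFun_elB]
    split_ifs <;> constructor <;> linarith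
  | one => exact ⟨0, fun x => by simp [toFun_one]⟩
  | mul f g hf hg =>
    obtain ⟨c, hc⟩ := hf
    obtain ⟨d, hd⟩ := hg
    refine ⟨d + c, fun x => ?_⟩
    rw [toFun_mul]
    exact (abs_sub_le _ (toFun f x) _).trans (add_le_add (hd _) (hc x))
  | inv g hg =>
    obtain ⟨c, hc⟩ := hg
    refine ⟨c, fun x => ?_⟩
    have h := hc (toFun g⁻¹ x)
    rwa [← toFun_mul, inv_mul_cancel, toFun_one, abs_sub_comm] at h

/-- All elements of `S` are translations on each of the two components of the complement of
`(-M, M)` and move no point by more than `M`. -/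
structure IsStepBound (S : Set FTilde) (M : ℝ) : Prop where
  one_le : 1 ≤ M
  bot : ∀ g ∈ S, ∀ x ≤ -M, toFun g x = x + shiftBot g
  top : ∀ g ∈ S, ∀ x, M ≤ x → toFun g x = x + shiftTop g
  displacement_le : ∀ g ∈ S, ∀ x, |toFun g x - x| ≤ M

lemma eventually_isStepBound_singleton (g : FTilde) : ∀ᶠ M in atTop, IsStepBound {g} M := by
  obtain ⟨a, ha⟩ := eventually_atBot.1 (shiftBot_spec g)
  obtain ⟨b, hb⟩ := eventually_atTop.1 (shiftTop_spec g)
  obtain ⟨d, hd⟩ := exists_abs_toFun_sub_le g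
  filter_upwards [eventually_ge_atTop 1, eventually_ge_atTop (-a), eventually_ge_atTop b,
    eventually_ge_atTop d] with M h1 hMa hMb hMd
  exact ⟨h1, by rintro _ rfl x hx; exact ha x (by linarith),
    by rintro _ rfl x hx; exact hb x (hMb.trans hx), by rintro _ rfl x; exact (hd x).trans hMd⟩

lemma exists_isStepBound {S : Set FTilde} (hS : S.Finite) : ∃ M, IsStepBound S M := by
  obtain ⟨M, hM, h1⟩ := (((hS.eventually_all).2 fun g _ =>
    eventually_isStepBound_singleton g).and (eventually_ge_atTop 1)).exists
  exact ⟨M, h1, fun g hg => (hM g hg).bot g rfl, fun g hg => (hM g hg).top g rfl,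
    fun g hg => (hM g hg).displacement_le g rfl⟩

section StepBound

variable {S : Set FTilde} {M : ℝ} {g : FTilde} {z : Vertex}

lemma IsStepBound.act_eq_translate_shiftBot (hM : IsStepBound S M) (hg : g ∈ S) (hz : z.1 ≤ -M) :
    act z g = translate z (shiftBot g) := Subtype.ext (hM.bot g hg _ hz)

lemma IsStepBound.act_eq_translate_shiftTop (hM : IsStepBound S M) (hg : g ∈ S) (hz : M ≤ z.1) :
    act z g = translate z (shiftTop g) := Subtype.ext (hM.top g hg _ hz)

lemma IsStepBound.act_lt_neg (hM : IsStepBound S M) (hg : g ∈ S) (hz : z.1 < -M)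
    (hout : M < |(act z g).1|) : (act z g).1 < -M := by
  have hdisp : (act z g).1 - z.1 ≤ M := (abs_le.1 (hM.displacement_le g hg z.1)).2
  rcases lt_abs.1 hout with h | h <;> linarith [hM.one_le]

lemma IsStepBound.lt_act (hM : IsStepBound S M) (hg : g ∈ S) (hz : M < z.1)
    (hout : M < |(act z g).1|) : M < (act z g).1 := by
  have hdisp : -M ≤ (act z g).1 - z.1 := (abs_le.1 (hM.displacement_le g hg z.1)).1
  rcases lt_abs.1 hout with h | h <;> linarith [hM.one_le]

end StepBound

section Drift

variable {μ : PMF FTilde} {hfin : μ.support.Finite} {M : ℝ}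

lemma IsStepBound.exists_expectedVisits_le_of_bot (hM : IsStepBound μ.support M)
    (hgen : Subsemigroup.closure μ.support = ⊤)
    (hdrift : ∑ g ∈ hfin.toFinset, (μ g).toReal * (shiftBot g : ℝ) < 0) :
    ∃ C : ℝ, ∀ N x, expectedVisits hfin {z : Vertex | |z.1| ≤ M} N x ≤ C := by
  refine exists_expectedVisits_le_of_drift hgen (p := fun z => z.1 + M) hdrift
    (fun g hg z hz => ?_) (fun z hz => ?_) (g := elA ^ (⌈2 * M⌉ + 1)) fun z hz => ?_
  · change (act z g).1 + M = _
    rw [hM.act_eq_translate_shiftBot hg (by linarith), coe_translate]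
    ring
  · linarith [(abs_le.1 (show |z.1| ≤ M from hz)).1]
  · have hz : |z.1| ≤ M := hz
    change (act z (elA ^ (⌈2 * M⌉ + 1))).1 + M ≤ _
    rw [act_elA_zpow, coe_translate]
    push_cast
    linarith [(abs_le.1 hz).2, Int.le_ceil (2 * M)]

lemma IsStepBound.exists_expectedVisits_le_of_top (hM : IsStepBound μ.support M)
    (hgen : Subsemigroup.closure μ.support = ⊤)
    (hdrift : 0 < ∑ g ∈ hfin.toFinset, (μ g).toReal * (shiftTop g : ℝ)) :
    ∃ C : ℝ, ∀ N x, expectedVisits hfin {z : Vertex | |z.1| ≤ M} N x ≤ C := by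
  refine exists_expectedVisits_le_of_drift hgen (p := fun z => M - z.1)
    (f := fun g => -(shiftTop g : ℝ)) ?_
    (fun g hg z hz => ?_) (fun z hz => ?_) (g := elA ^ (-(⌈2 * M⌉ + 1))) fun z hz => ?_
  · simpa only [mul_neg, Finset.sum_neg_distrib, neg_lt_zero] using hdrift
  · change M - (act z g).1 = _
    rw [hM.act_eq_translate_shiftTop hg (by linarith), coe_translate]
    ring
  · linarith [(abs_le.1 (show |z.1| ≤ M from hz)).2]
  · have hz : |z.1| ≤ M := hz
    change M - (act z (elA ^ (-(⌈2 * M⌉ + 1)))).1 ≤ _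
    rw [act_elA_zpow, coe_translate, neg_neg]
    push_cast
    linarith [(abs_le.1 hz).1, Int.le_ceil (2 * M)]

end Drift

section Trajectory

variable {S : Set FTilde} {M : ℝ} {x : Vertex} {h : ℕ → FTilde} {N : ℕ}

lemma exists_trajectory_eq_translate_sum {f : FTilde → ℤ}
    (hf : ∀ n, N ≤ n → act (trajectory x h n) (h n) = translate (trajectory x h n) (f (h n))) :
    ∃ z, ∀ n, N ≤ n → trajectory x h n = translate z (∑ i ∈ Finset.range n, f (h i)) := by
  refine ⟨translate (trajectory x h N) (-∑ i ∈ Finset.range N, f (h i)), fun n hn => ?_⟩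
  induction n, hn using Nat.le_induction with
  | base => rw [translate_translate, neg_add_cancel, translate_zero]
  | succ n hn ih =>
    rw [trajectory_succ, hf n hn, Finset.sum_range_succ, ← translate_translate _ _ (f (h n)), ← ih]

lemma bddAbove_range_of_translate_le {z : Vertex} {s : ℕ → ℤ} {c : ℝ}
    (hs : ∀ n, N ≤ n → (translate z (s n)).1 ≤ c) : BddAbove (Set.range s) := by
  refine IsBoundedUnder.bddAbove_range ⟨⌊c - z.1⌋, eventually_map.2 ?_⟩
  filter_upwards [eventually_ge_atTop N] with n hn
  have hle := hs n hn
  rw [coe_translate] at hle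
  exact Int.le_floor.2 (by linarith)

lemma bddBelow_range_of_le_translate {z : Vertex} {s : ℕ → ℤ} {c : ℝ}
    (hs : ∀ n, N ≤ n → c ≤ (translate z (s n)).1) : BddBelow (Set.range s) := by
  refine IsBoundedUnder.bddBelow_range ⟨⌈c - z.1⌉, eventually_map.2 ?_⟩
  filter_upwards [eventually_ge_atTop N] with n hn
  have hle := hs n hn
  rw [coe_translate] at hle
  exact Int.ceil_le.2 (by linarith)

lemma IsStepBound.exists_trajectory_eq_translate_sum_shiftBot (hM : IsStepBound S M)
    (hh : ∀ n, h n ∈ S) (hlt : ∀ n, N ≤ n → (trajectory x h n).1 < -M) :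
    ∃ z, ∀ n, N ≤ n → trajectory x h n = translate z (∑ i ∈ Finset.range n, shiftBot (h i)) :=
  exists_trajectory_eq_translate_sum fun n hn =>
    hM.act_eq_translate_shiftBot (hh n) (hlt n hn).le

lemma IsStepBound.exists_trajectory_eq_translate_sum_shiftTop (hM : IsStepBound S M)
    (hh : ∀ n, h n ∈ S) (hlt : ∀ n, N ≤ n → M < (trajectory x h n).1) :
    ∃ z, ∀ n, N ≤ n → trajectory x h n = translate z (∑ i ∈ Finset.range n, shiftTop (h i)) :=
  exists_trajectory_eq_translate_sum fun n hn =>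
    hM.act_eq_translate_shiftTop (hh n) (hlt n hn).le

lemma IsStepBound.bddAbove_sum_shiftBot (hM : IsStepBound S M) (hh : ∀ n, h n ∈ S)
    (hlt : ∀ n, N ≤ n → (trajectory x h n).1 < -M) :
    BddAbove (Set.range fun n => ∑ i ∈ Finset.range n, shiftBot (h i)) := by
  obtain ⟨z, hz⟩ := hM.exists_trajectory_eq_translate_sum_shiftBot hh hlt
  exact bddAbove_range_of_translate_le fun n hn => by rw [← hz n hn]; exact (hlt n hn).le

lemma IsStepBound.bddBelow_sum_shiftTop (hM : IsStepBound S M) (hh : ∀ n, h n ∈ S)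
    (hlt : ∀ n, N ≤ n → M < (trajectory x h n).1) :
    BddBelow (Set.range fun n => ∑ i ∈ Finset.range n, shiftTop (h i)) := by
  obtain ⟨z, hz⟩ := hM.exists_trajectory_eq_translate_sum_shiftTop hh hlt
  exact bddBelow_range_of_le_translate fun n hn => by rw [← hz n hn]; exact (hlt n hn).le

lemma IsStepBound.mem_endsMinus (hM : IsStepBound S M) (hh : ∀ n, h n ∈ S) {ω : Ends}
    (hω : ConvergesToEnd (trajectory x h) ω) (hcof : Tendsto (trajectory x h) atTop cofinite)
    (hlt : ∀ n, N ≤ n → (trajectory x h n).1 < -M) : ω ∈ endsMinus := by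
  obtain ⟨z, hz⟩ := hM.exists_trajectory_eq_translate_sum_shiftBot hh hlt
  exact mem_endsMinus_of_eventually hω hcof <| eventually_atTop.2
    ⟨N, fun n hn => ⟨by linarith [hlt n hn, hM.one_le], _, hz n hn⟩⟩

lemma IsStepBound.mem_endsPlus (hM : IsStepBound S M) (hh : ∀ n, h n ∈ S) {ω : Ends}
    (hω : ConvergesToEnd (trajectory x h) ω) (hcof : Tendsto (trajectory x h) atTop cofinite)
    (hlt : ∀ n, N ≤ n → M < (trajectory x h n).1) : ω ∈ endsPlus := by
  obtain ⟨z, hz⟩ := hM.exists_trajectory_eq_translate_sum_shiftTop hh hlt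
  exact mem_endsPlus_of_eventually hω hcof <| eventually_atTop.2
    ⟨N, fun n hn => ⟨by linarith [hlt n hn, hM.one_le], _, hz n hn⟩⟩

/-- The cases of interest are `T = univ` and `T` an orbit of the integer translations. -/
lemma IsStepBound.trajectory_lt_neg_or_lt (hM : IsStepBound S M) (hh : ∀ n, h n ∈ S)
    {T : Set Vertex} (hT : ∀ z ∈ T, ∀ c, translate z c ∈ T) (hN : trajectory x h N ∈ T)
    (hout : ∀ n, N ≤ n → trajectory x h n ∈ T → M < |(trajectory x h n).1|) :
    (∀ n, N ≤ n → (trajectory x h n).1 < -M) ∨ ∀ n, N ≤ n → M < (trajectory x h n).1 := by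
  rcases lt_abs.1 (hout N le_rfl hN) with hlt | hlt
  · suffices hstay : ∀ n, N ≤ n → trajectory x h n ∈ T ∧ M < (trajectory x h n).1 from
      .inr fun n hn => (hstay n hn).2
    intro n hn
    induction n, hn using Nat.le_induction with
    | base => exact ⟨hN, hlt⟩
    | succ n hn ih =>
      have hmem : trajectory x h (n + 1) ∈ T := by
        rw [trajectory_succ, hM.act_eq_translate_shiftTop (hh n) ih.2.le]
        exact hT _ ih.1 _
      exact ⟨hmem, hM.lt_act (z := trajectory x h n) (hh n) ih.2 (hout _ (hn.trans n.le_succ) hmem)⟩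
  · suffices hstay : ∀ n, N ≤ n → trajectory x h n ∈ T ∧ (trajectory x h n).1 < -M from
      .inl fun n hn => (hstay n hn).2
    intro n hn
    induction n, hn using Nat.le_induction with
    | base => exact ⟨hN, lt_neg_of_lt_neg hlt⟩
    | succ n hn ih =>
      have hmem : trajectory x h (n + 1) ∈ T := by
        rw [trajectory_succ, hM.act_eq_translate_shiftBot (hh n) ih.2.le]
        exact hT _ ih.1 _
      exact ⟨hmem, hM.act_lt_neg (z := trajectory x h n) (hh n) ih.2
        (hout _ (hn.trans n.le_succ) hmem)⟩

lemma IsStepBound.mem_endsMinus_or_mem_endsPlus (hM : IsStepBound S M) (hh : ∀ n, h n ∈ S)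
    {ω : Ends} (hω : ConvergesToEnd (trajectory x h) ω)
    (hcof : Tendsto (trajectory x h) atTop cofinite)
    (hout : ∀ᶠ n in atTop, M < |(trajectory x h n).1|) :
    (ω ∈ endsMinus ∧ BddAbove (Set.range fun n => ∑ i ∈ Finset.range n, shiftBot (h i))) ∨
      (ω ∈ endsPlus ∧ BddBelow (Set.range fun n => ∑ i ∈ Finset.range n, shiftTop (h i))) := by
  obtain ⟨N, hN⟩ := eventually_atTop.1 hout
  exact (hM.trajectory_lt_neg_or_lt hh (T := Set.univ) (fun _ _ _ => trivial) trivial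
    fun n hn _ => hN n hn).imp
      (fun hlt => ⟨hM.mem_endsMinus hh hω hcof hlt, hM.bddAbove_sum_shiftBot hh hlt⟩)
      (fun hlt => ⟨hM.mem_endsPlus hh hω hcof hlt, hM.bddBelow_sum_shiftTop hh hlt⟩)

lemma finite_setOf_translate_abs_le (y : Vertex) (M : ℝ) :
    {z : Vertex | z ∈ Set.range (translate y) ∧ |z.1| ≤ M}.Finite := by
  refine ((Set.finite_Icc ⌈-M - y.1⌉ ⌊M - y.1⌋).image (translate y)).subset ?_
  rintro _ ⟨⟨j, rfl⟩, hj⟩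
  rw [coe_translate] at hj
  obtain ⟨hlo, hhi⟩ := abs_le.1 hj
  exact ⟨j, ⟨Int.ceil_le.2 (by linarith), Int.le_floor.2 (by linarith)⟩, rfl⟩

lemma IsStepBound.tendsto_retract (hM : IsStepBound S M) (hh : ∀ n, h n ∈ S)
    (hcof : Tendsto (trajectory x h) atTop cofinite)
    (hbot : ¬ BddAbove (Set.range fun n => ∑ i ∈ Finset.range n, shiftBot (h i)))
    (htop : ¬ BddBelow (Set.range fun n => ∑ i ∈ Finset.range n, shiftTop (h i))) :
    Tendsto (fun n => retract (trajectory x h n)) atTop cofinite := by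
  refine le_cofinite_iff_eventually_ne.2 fun y => eventually_map.2 ?_
  obtain ⟨N, hN⟩ := eventually_atTop.1
    (hcof.eventually (finite_setOf_translate_abs_le y M).compl_mem_cofinite)
  refine eventually_atTop.2 ⟨N, fun n hn hy => ?_⟩
  have hmem : trajectory x h n ∈ Set.range (translate y) := by
    rw [← hy, retract]
    exact ⟨-_, by rw [translate_translate, add_neg_cancel, translate_zero]⟩
  have htranslate : ∀ z ∈ Set.range (translate y), ∀ c,
      translate z c ∈ Set.range (translate y) := by
    rintro _ ⟨a, rfl⟩ c
    exact ⟨a + c, (translate_translate y a c).symm⟩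
  rcases hM.trajectory_lt_neg_or_lt hh htranslate hmem
    fun k hk hmem => not_le.1 fun hle => hN k (hn.trans hk) ⟨hmem, hle⟩ with hlt | hlt
  · exact hbot (hM.bddAbove_sum_shiftBot hh hlt)
  · exact htop (hM.bddBelow_sum_shiftTop hh hlt)

end Trajectory

/-! ## Measurability of the limit end field -/

lemma countable_componentCompl {V : Type*} [Countable V] (G : SimpleGraph V) (K : Set V) :
    Countable (G.ComponentCompl K) :=
  inferInstanceAs (Countable (Quot _))

lemma measurableSpace_ends_eq : (inferInstance : MeasurableSpace Ends) =
    MeasurableSpace.comap Ends.comp (@MeasurableSpace.pi _ _ fun _ => ⊤) := by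
  let (K : Finset Vertex) : TopologicalSpace (schreier.ComponentCompl (K : Set Vertex)) := ⊥
  have (K : Finset Vertex) : DiscreteTopology (schreier.ComponentCompl (K : Set Vertex)) := ⟨rfl⟩
  let (K : Finset Vertex) : MeasurableSpace (schreier.ComponentCompl (K : Set Vertex)) := ⊤
  have (K : Finset Vertex) : BorelSpace (schreier.ComponentCompl (K : Set Vertex)) :=
    ⟨borel_eq_top_of_discrete.symm⟩
  have (K : Finset Vertex) := countable_componentCompl schreier (K : Set Vertex)
  rw [BorelSpace.measurable_eq (α := ∀ K : Finset Vertex, schreier.ComponentCompl (K : Set Vertex)),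
    ← borel_comap]
  rfl

lemma measurableSet_comp_eq (K : Finset Vertex) (C : schreier.ComponentCompl (K : Set Vertex)) :
    MeasurableSet {ω : Ends | ω.comp K = C} := by
  let (K : Finset Vertex) : MeasurableSpace (schreier.ComponentCompl (K : Set Vertex)) := ⊤
  have hcomp : Measurable Ends.comp := measurable_iff_comap_le.2 measurableSpace_ends_eq.ge
  exact (measurable_pi_iff.1 hcomp K) (MeasurableSpace.measurableSet_top (s := {C}))

lemma measurable_of_measurableSet_comp_eq {X : Type*} [MeasurableSpace X] {f : X → Ends}
    (hf : ∀ (K : Finset Vertex) (C : schreier.ComponentCompl (K : Set Vertex)),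
      MeasurableSet {x | (f x).comp K = C}) : Measurable f := by
  let (K : Finset Vertex) : MeasurableSpace (schreier.ComponentCompl (K : Set Vertex)) := ⊤
  have (K : Finset Vertex) := countable_componentCompl schreier (K : Set Vertex)
  have hcomp : Measurable fun x => (f x).comp :=
    measurable_pi_iff.2 fun K => measurable_to_countable' fun C => hf K C
  refine measurable_iff_comap_le.2
    ((MeasurableSpace.comap_mono measurableSpace_ends_eq.le).trans ?_)
  rw [MeasurableSpace.comap_comp]
  exact measurable_iff_comap_le.1 hcomp

instance : MeasurableSingletonClass Ends where
  measurableSet_singleton ω := by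
    have h : ({ω} : Set Ends) = ⋂ K : Finset Vertex, {η : Ends | η.comp K = ω.comp K} := by
      ext η
      simp only [Set.mem_singleton_iff, Set.mem_iInter, Set.mem_ofPred_eq]
      exact ⟨fun h K => by rw [h], fun h => Subtype.ext (funext fun K => h K.unop)⟩
    rw [h]
    exact MeasurableSet.iInter fun K => measurableSet_comp_eq K _

lemma countable_of_forall_exists_convergesToEnd {ι : Type*} [Countable ι] {A : Set Ends}
    (x : ι → ℕ → Vertex) (h : ∀ ω ∈ A, ∃ i, ConvergesToEnd (x i) ω) : A.Countable := by
  choose f hf using fun ω : A => h ω.1 ω.2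
  refine Set.countable_coe_iff.1 (Function.Injective.countable (f := f) fun ω η hωη => ?_)
  exact Subtype.ext ((hf ω).unique (hωη ▸ hf η))

lemma measurableSet_endsMinus : MeasurableSet endsMinus :=
  (countable_of_forall_exists_convergesToEnd (A := endsMinus)
    (fun y n => translate y (-(n : ℤ))) fun _ ⟨y, _, _, h⟩ => ⟨y, h⟩).measurableSet

lemma measurableSet_endsPlus : MeasurableSet endsPlus :=
  (countable_of_forall_exists_convergesToEnd (A := endsPlus)
    (fun y n => translate y n) fun _ ⟨y, _, _, h⟩ => ⟨y, h⟩).measurableSet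

lemma measurableSet_mem_supp (K : Finset Vertex) (y : Vertex) :
    MeasurableSet {ω : Ends | y ∈ (ω.comp K).supp} := by
  by_cases hy : y ∈ (K : Set Vertex)
  · have h : {ω : Ends | y ∈ (ω.comp K).supp} = ∅ :=
      Set.eq_empty_of_forall_notMem fun ω hω => hω.1 hy
    exact h ▸ MeasurableSet.empty
  · have h : {ω : Ends | y ∈ (ω.comp K).supp} =
        {ω : Ends | ω.comp K = schreier.componentComplMk hy} :=
      Set.ext fun ω => ⟨fun ⟨_, h⟩ => h.symm, fun h => ⟨hy, h.symm⟩⟩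
    exact h ▸ measurableSet_comp_eq K _

lemma measurableSet_endsSkeleton : MeasurableSet endsSkeleton := by
  have h : endsSkeleton =
      ⋂ K : Finset Vertex, ⋃ y ∈ skeletonVertices, {ω : Ends | y ∈ (ω.comp K).supp} := by
    ext ω
    simp only [mem_endsSkeleton_iff, Set.mem_iInter, Set.mem_iUnion, Set.mem_ofPred_eq,
      exists_prop]
  rw [h]
  exact MeasurableSet.iInter fun K => MeasurableSet.biUnion (Set.to_countable _) fun y _ =>
    measurableSet_mem_supp K y

lemma ConvergesToEnd.limitEnd_eq {x : ℕ → Vertex} {ω : Ends} (h : ConvergesToEnd x ω) :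
    limitEnd x = ω :=
  (Classical.epsilon_spec (p := fun ω => ConvergesToEnd x ω) ⟨ω, h⟩).unique h

lemma limitEnd_of_not_exists {x : ℕ → Vertex} (h : ¬ ∃ ω, ConvergesToEnd x ω) :
    limitEnd x = Classical.epsilon fun _ => False := by
  rw [limitEnd, funext fun ω => eq_false (not_exists.1 h ω)]

lemma ConvergesToEnd.comp_eq_iff {x : ℕ → Vertex} {ω : Ends} (h : ConvergesToEnd x ω)
    {K : Finset Vertex} {C : schreier.ComponentCompl (K : Set Vertex)} :
    ω.comp K = C ↔ ∀ᶠ n in atTop, x n ∈ C.supp := by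
  refine ⟨fun hC => hC ▸ h K, fun hC => ?_⟩
  obtain ⟨n, hω, hn⟩ := ((h K).and hC).exists
  exact eq_of_mem_supp hω hn

lemma measurableSet_eventually_mem {X : Type*} [MeasurableSpace X] {T : Set X}
    (hT : MeasurableSet T) : MeasurableSet {x : ℕ → X | ∀ᶠ n in atTop, x n ∈ T} := by
  convert MeasurableSet.measurableSet_liminf (s := fun n => {x : ℕ → X | x n ∈ T})
    fun n => measurable_pi_apply n hT
  ext x
  simp only [mem_liminf_iff_eventually_mem, Set.mem_ofPred_eq]

lemma measurableSet_exists_convergesToEnd :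
    MeasurableSet {x : ℕ → Vertex | ∃ ω, ConvergesToEnd x ω} := by
  have (K : Finset Vertex) := countable_componentCompl schreier (K : Set Vertex)
  have h : {x : ℕ → Vertex | ∃ ω, ConvergesToEnd x ω} =
      ⋂ K : Finset Vertex, ⋃ C : schreier.ComponentCompl (K : Set Vertex),
        {x | ∀ᶠ n in atTop, x n ∈ C.supp} := by
    ext x
    simp only [Set.mem_iInter, Set.mem_iUnion, Set.mem_ofPred_eq]
    exact ⟨fun ⟨ω, hω⟩ K => ⟨ω.comp K, hω K⟩, exists_convergesToEnd_of_eventually_mem⟩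
  rw [h]
  exact MeasurableSet.iInter fun K => MeasurableSet.iUnion fun C =>
    measurableSet_eventually_mem (Set.to_countable _).measurableSet

lemma measurable_limitEnd : Measurable limitEnd := by
  refine measurable_of_measurableSet_comp_eq fun K C => ?_
  have h : {x | (limitEnd x).comp K = C} =
      {x : ℕ → Vertex | ∃ ω, ConvergesToEnd x ω}.ite {x | ∀ᶠ n in atTop, x n ∈ C.supp}
        {_x | (Classical.epsilon fun _ : Ends => False).comp K = C} := by
    ext x
    by_cases hx : ∃ ω, ConvergesToEnd x ω
    · obtain ⟨ω, hω⟩ := id hx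
      simp [Set.ite, hx, hω.limitEnd_eq, hω.comp_eq_iff]
    · simp [Set.ite, hx, limitEnd_of_not_exists hx]
  rw [h]
  exact measurableSet_exists_convergesToEnd.ite
    (measurableSet_eventually_mem (Set.to_countable _).measurableSet) (MeasurableSet.const _)

lemma measurable_endField : Measurable endField := by
  refine measurable_pi_lambda _ fun x =>
    measurable_limitEnd.comp (measurable_pi_lambda _ fun n => ?_)
  exact (measurable_of_countable fun g => act x g).comp (measurable_pi_apply n)

lemma measurableSet_endFields {A : Set Ends} (hA : MeasurableSet A) :
    MeasurableSet (endFields A) := by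
  have h : endFields A = Set.univ.pi fun _ => A := Set.ext fun φ => by simp [endFields]
  exact h ▸ MeasurableSet.univ_pi fun _ => hA

lemma range_positions : Set.range positions = {g | g 0 = 1} := by
  refine Set.ext fun g => ⟨?_, fun hg => ⟨fun n => (g n)⁻¹ * g (n + 1), funext fun n => ?_⟩⟩
  · rintro ⟨h, rfl⟩
    rfl
  · induction n with
    | zero => exact hg.symm
    | succ n ih => rw [positions, ih, mul_inv_cancel_left]

lemma measurableEmbedding_positions : MeasurableEmbedding positions := by
  refine MeasurableEmbedding.of_measurable_inverse (g := fun g n => (g n)⁻¹ * g (n + 1))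
    measurable_positions ?_ (measurable_pi_lambda _ fun n => ?_)
    fun h => funext fun n => inv_mul_cancel_left _ _
  · rw [range_positions]
    exact measurable_pi_apply (X := fun _ : ℕ => FTilde) 0 (measurableSet_singleton 1)
  · have hdiv : Measurable fun p : FTilde × FTilde => p.1⁻¹ * p.2 := measurable_of_countable _
    exact hdiv.comp ((measurable_pi_apply (X := fun _ : ℕ => FTilde) n).prodMk
      (measurable_pi_apply (n + 1)))

section Limits

variable {μ : PMF FTilde}

lemma ae_pathMeasure_iff {p : (ℕ → FTilde) → Prop} :
    (∀ᵐ g ∂pathMeasure μ, p g) ↔ ∀ᵐ h ∂stepMeasure μ, p (positions h) :=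
  measurableEmbedding_positions.ae_map_iff

lemma limitMeasure_endFields_compl_eq_zero {A : Set Ends} (hA : MeasurableSet A)
    (h : ∀ᵐ h ∂stepMeasure μ, ∀ x, ∃ ω ∈ A, ConvergesToEnd (trajectory x h) ω) :
    limitMeasure μ (endFields A)ᶜ = 0 := by
  refine (ae_map_iff measurable_endField.aemeasurable (measurableSet_endFields hA)).2
    (ae_pathMeasure_iff.2 ?_)
  filter_upwards [h] with h hh x
  obtain ⟨ω, hω, hlim⟩ := hh x
  rwa [← hlim.limitEnd_eq] at hω

/-! ## Almost sure limits -/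

lemma sum_shiftBot_eq_neg_barycentre (hfin : μ.support.Finite) :
    ∑ g ∈ hfin.toFinset, (μ g).toReal * (shiftBot g : ℝ) =
      -barycentre (imageMeasure chiA μ) := by
  rw [barycentre_imageMeasure hfin, ← Finset.sum_neg_distrib]
  refine Finset.sum_congr rfl fun g _ => ?_
  rw [show (chiA g).toAdd = -shiftBot g from rfl, Int.cast_neg, mul_neg, neg_neg]

lemma sum_shiftTop_eq_neg_barycentre_add (hfin : μ.support.Finite) :
    ∑ g ∈ hfin.toFinset, (μ g).toReal * (shiftTop g : ℝ) =
      -(barycentre (imageMeasure chiA μ) + barycentre (imageMeasure chiB μ)) := by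
  rw [barycentre_imageMeasure hfin, barycentre_imageMeasure hfin, ← Finset.sum_add_distrib,
    ← Finset.sum_neg_distrib]
  refine Finset.sum_congr rfl fun g _ => ?_
  rw [show (chiA g).toAdd = -shiftBot g from rfl,
    show (chiB g).toAdd = shiftBot g - shiftTop g from rfl]
  push_cast
  ring

lemma ae_eventually_lt_abs (hfin : μ.support.Finite) (hgen : Subsemigroup.closure μ.support = ⊤)
    {M : ℝ} (hM : IsStepBound μ.support M)
    (hdrift : 0 < barycentre (imageMeasure chiA μ) ∨
      barycentre (imageMeasure chiA μ) + barycentre (imageMeasure chiB μ) < 0) :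
    ∀ᵐ h ∂stepMeasure μ, ∀ x, ∀ᶠ n in atTop, M < |(trajectory x h n).1| := by
  obtain ⟨C, hC⟩ : ∃ C : ℝ, ∀ N x, expectedVisits hfin {z : Vertex | |z.1| ≤ M} N x ≤ C := by
    refine hdrift.elim (fun hα => hM.exists_expectedVisits_le_of_bot hgen ?_)
      (fun hαβ => hM.exists_expectedVisits_le_of_top hgen ?_)
    · simpa only [sum_shiftBot_eq_neg_barycentre, neg_lt_zero] using hα
    · simpa only [sum_shiftTop_eq_neg_barycentre_add, neg_pos] using hαβ
  refine ae_all_iff.2 fun x => ?_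
  filter_upwards [ae_eventually_trajectory_notMem hfin ⟨C, fun N => hC N x⟩] with h hh
  exact hh.mono fun n hn => not_le.1 hn

lemma ae_not_bddAbove_sum_shiftBot (hfin : μ.support.Finite)
    (hgen : Subsemigroup.closure μ.support = ⊤) (hα : barycentre (imageMeasure chiA μ) ≤ 0) :
    ∀ᵐ h ∂stepMeasure μ,
      ¬ BddAbove (Set.range fun n => ∑ i ∈ Finset.range n, shiftBot (h i)) := by
  refine ae_not_bddAbove_sum_increments hfin
    (exists_mem_support_ne_zero hgen shiftBot_mul (g := elA) (by simp [shiftBot_elA])) ?_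
  rwa [sum_shiftBot_eq_neg_barycentre, neg_nonneg]

lemma ae_not_bddBelow_sum_shiftTop (hfin : μ.support.Finite)
    (hgen : Subsemigroup.closure μ.support = ⊤)
    (hαβ : 0 ≤ barycentre (imageMeasure chiA μ) + barycentre (imageMeasure chiB μ)) :
    ∀ᵐ h ∂stepMeasure μ,
      ¬ BddBelow (Set.range fun n => ∑ i ∈ Finset.range n, shiftTop (h i)) := by
  have hne : ∃ g ∈ μ.support, -shiftTop g ≠ 0 :=
    exists_mem_support_ne_zero hgen (f := fun g => -shiftTop g) (g := elA)
      (fun f g => by rw [shiftTop_mul, neg_add]) (by simp [shiftTop_elA])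
  have hmean : 0 ≤ ∑ g ∈ hfin.toFinset, (μ g).toReal * ((-shiftTop g : ℤ) : ℝ) := by
    simpa only [Int.cast_neg, mul_neg, Finset.sum_neg_distrib, sum_shiftTop_eq_neg_barycentre_add,
      neg_neg] using hαβ
  filter_upwards [ae_not_bddAbove_sum_increments hfin hne hmean] with h hh hbdd
  refine hh ?_
  simpa only [Finset.sum_neg_distrib, ← Set.image_neg_eq_neg, ← Set.range_comp,
    Function.comp_def] using hbdd.neg

lemma ae_exists_mem_endsMinus_or_endsPlus (hfin : μ.support.Finite)
    (hgen : Subsemigroup.closure μ.support = ⊤)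
    (hdrift : 0 < barycentre (imageMeasure chiA μ) ∨
      barycentre (imageMeasure chiA μ) + barycentre (imageMeasure chiB μ) < 0) :
    ∀ᵐ h ∂stepMeasure μ, ∀ x, ∃ ω, ConvergesToEnd (trajectory x h) ω ∧
      ((ω ∈ endsMinus ∧ BddAbove (Set.range fun n => ∑ i ∈ Finset.range n, shiftBot (h i))) ∨
        (ω ∈ endsPlus ∧
          BddBelow (Set.range fun n => ∑ i ∈ Finset.range n, shiftTop (h i)))) := by
  obtain ⟨M, hM⟩ := exists_isStepBound hfin
  filter_upwards [ae_forall_mem_support μ, ae_tendsto_cofinite hfin hgen,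
    ae_exists_convergesToEnd hfin hgen, ae_eventually_lt_abs hfin hgen hM hdrift]
    with h hsupp hcof hlim hout x
  obtain ⟨ω, hω⟩ := hlim x
  exact ⟨ω, hω, hM.mem_endsMinus_or_mem_endsPlus hsupp hω (hcof x) (hout x)⟩

theorem ae_exists_mem_endsMinus_union_endsPlus (hfin : μ.support.Finite)
    (hgen : Subsemigroup.closure μ.support = ⊤)
    (hdrift : 0 < barycentre (imageMeasure chiA μ) ∨
      barycentre (imageMeasure chiA μ) + barycentre (imageMeasure chiB μ) < 0) :
    ∀ᵐ h ∂stepMeasure μ, ∀ x, ∃ ω ∈ endsMinus ∪ endsPlus, ConvergesToEnd (trajectory x h) ω := by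
  filter_upwards [ae_exists_mem_endsMinus_or_endsPlus hfin hgen hdrift] with h hh x
  obtain ⟨ω, hω, hcases⟩ := hh x
  exact ⟨ω, hcases.imp And.left And.left, hω⟩

theorem ae_exists_mem_endsMinus (hfin : μ.support.Finite)
    (hgen : Subsemigroup.closure μ.support = ⊤) (hα : 0 < barycentre (imageMeasure chiA μ))
    (hαβ : 0 ≤ barycentre (imageMeasure chiA μ) + barycentre (imageMeasure chiB μ)) :
    ∀ᵐ h ∂stepMeasure μ, ∀ x, ∃ ω ∈ endsMinus, ConvergesToEnd (trajectory x h) ω := by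
  filter_upwards [ae_exists_mem_endsMinus_or_endsPlus hfin hgen (.inl hα),
    ae_not_bddBelow_sum_shiftTop hfin hgen hαβ] with h hh hnot x
  obtain ⟨ω, hω, hcases⟩ := hh x
  exact ⟨ω, (hcases.resolve_right fun hplus => hnot hplus.2).1, hω⟩

theorem ae_exists_mem_endsPlus (hfin : μ.support.Finite)
    (hgen : Subsemigroup.closure μ.support = ⊤) (hα : barycentre (imageMeasure chiA μ) ≤ 0)
    (hαβ : barycentre (imageMeasure chiA μ) + barycentre (imageMeasure chiB μ) < 0) :
    ∀ᵐ h ∂stepMeasure μ, ∀ x, ∃ ω ∈ endsPlus, ConvergesToEnd (trajectory x h) ω := by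
  filter_upwards [ae_exists_mem_endsMinus_or_endsPlus hfin hgen (.inr hαβ),
    ae_not_bddAbove_sum_shiftBot hfin hgen hα] with h hh hnot x
  obtain ⟨ω, hω, hcases⟩ := hh x
  exact ⟨ω, (hcases.resolve_left fun hminus => hnot hminus.2).1, hω⟩

theorem ae_exists_mem_endsSkeleton (hfin : μ.support.Finite)
    (hgen : Subsemigroup.closure μ.support = ⊤) (hα : barycentre (imageMeasure chiA μ) ≤ 0)
    (hαβ : 0 ≤ barycentre (imageMeasure chiA μ) + barycentre (imageMeasure chiB μ)) :
    ∀ᵐ h ∂stepMeasure μ, ∀ x, ∃ ω ∈ endsSkeleton, ConvergesToEnd (trajectory x h) ω := by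
  obtain ⟨M, hM⟩ := exists_isStepBound hfin
  filter_upwards [ae_forall_mem_support μ, ae_tendsto_cofinite hfin hgen,
    ae_exists_convergesToEnd hfin hgen, ae_not_bddAbove_sum_shiftBot hfin hgen hα,
    ae_not_bddBelow_sum_shiftTop hfin hgen hαβ] with h hsupp hcof hlim hbot htop x
  obtain ⟨ω, hω⟩ := hlim x
  exact ⟨ω, mem_endsSkeleton_of_tendsto_retract hω
    (hM.tendsto_retract hsupp (hcof x) hbot htop), hω⟩

end Limits

end ThompsonEnds

open ThompsonEnds in
theorem mainTheorem7 (μ : PMF FTilde) (hfin : μ.support.Finite)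
    (hgen : Subsemigroup.closure μ.support = ⊤) (α β : ℝ)
    (hα : α = barycentre (imageMeasure chiA μ)) (hβ : β = barycentre (imageMeasure chiB μ)) :
    (∀ᵐ g ∂(pathMeasure μ), ∀ x : Vertex, ∃ ω : Ends,
        ConvergesToEnd (fun n => act x (g n)) ω) ∧
      MeasureTheory.IsProbabilityMeasure (limitMeasure μ) ∧
      (0 < α → α + β < 0 → limitMeasure μ (endFields (endsMinus ∪ endsPlus))ᶜ = 0) ∧
      (0 < α → 0 ≤ α + β → limitMeasure μ (endFields endsMinus)ᶜ = 0) ∧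
      (α ≤ 0 → α + β < 0 → limitMeasure μ (endFields endsPlus)ᶜ = 0) ∧
      (α ≤ 0 → 0 ≤ α + β → limitMeasure μ (endFields endsSkeleton)ᶜ = 0) := by
  subst hα hβ
  refine ⟨ae_pathMeasure_iff.2 (ae_exists_convergesToEnd hfin hgen),
    Measure.isProbabilityMeasure_map measurable_endField.aemeasurable,
    fun hα _ => limitMeasure_endFields_compl_eq_zero
      (measurableSet_endsMinus.union measurableSet_endsPlus)
      (ae_exists_mem_endsMinus_union_endsPlus hfin hgen (.inl hα)),
    fun hα hαβ => limitMeasure_endFields_compl_eq_zero measurableSet_endsMinus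
      (ae_exists_mem_endsMinus hfin hgen hα hαβ),
    fun hα hαβ => limitMeasure_endFields_compl_eq_zero measurableSet_endsPlus
      (ae_exists_mem_endsPlus hfin hgen hα hαβ),
    fun hα hαβ => limitMeasure_endFields_compl_eq_zero measurableSet_endsSkeleton
      (ae_exists_mem_endsSkeleton hfin hgen hα hαβ)⟩
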